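/- **Conventions.** Let $\mathcal E$ be a category with pullbacks in which every pullback functor $f^*\colon \mathcal E_{/Y}\to\mathcal E_{/X}$ along $f\colon X\to Y$ has a right adjoint $f_*$ (pushforward along $f$); for instance, $\mathcal E$ may be a locally presentable, locally cartesian closed category. For a functor $u\colon\mathcal I\to\mathcal E^\to$ write $u_i\colon A_i\to B_i$ for its value at $i$. *Lifts* of functors and of natural transformations are understood strictly, i.e. the squares of functors commute on the nose. * A *right $\mathcal I$-map* is an arrow $f$ of $\mathcal E$ with a choice of diagonal filler for each commutative square from some $u_i$ to $f$, natural in $i$; morphisms are squares compatible with the fillers. These form a category $\mathcal I^{\pitchfork}$ over $\mathcal E^\to$. Dually, arrows with chosen fillers against all $u_i$ on the right form the category ${}^{\pitchfork}\mathcal I$ over $\mathcal E^\to$. * An *algebraic weak factorization system* (awfs) $(\mathsf L,\mathsf R)$ is a functorial factorization $f=Rf\circ Lf$ together with a comultiplication making $L$, with its canonical copointing $L\to\mathrm{Id}$, a comonad $\mathsf L$ on $\mathcal E^\to$, and a multiplication making $R$, with its canonical pointing $\mathrm{Id}\to R$, a monad $\mathsf R$, such that the canonical natural transformation $LR\to RL$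 is a distributive law. $\mathsf R\text{-}\mathbf{Alg}$ denotes the category of algebras for the monad, and $\mathsf R\text{-}\mathbf{alg}$, $\mathsf L\text{-}\mathbf{coalg}$ the categories of (co)algebras for the underlying pointed, respectively copointed, endofunctors. The awfs is *algebraically free* on $u\colon\mathcal I\to\mathcal E^\to$ if there is an isomorphism of categories $\mathsf R\text{-}\mathbf{Alg}\cong\mathcal I^{\pitchfork}$ over $\mathcal E^\to$. * $(\mathsf L,\mathsf R)$ satisfies the *functorial Frobenius condition* if the functor $P\colon\mathcal E^\to\times_{\mathcal E}\mathcal E^\to\to\mathcal E^\to$, $(g,h)\mapsto h^*g$ (for $g$, $h$ with common codomain), lifts to a functor $\mathsf L\text{-}\mathbf{coalg}\times_{\mathcal E}\mathsf R\text{-}\mathbf{alg}\to\mathsf L\text{-}\mathbf{coalg}$. * For $u\colon\mathcal I\to\mathcal E^\to$, $\mathcal I_{/\mathcal E}$ is the category of triples of an object $X\in\mathcal E$, an object $i\in\mathcal I$ and a commutative triangle from $u_i\colon A_i\to B_i$ to $X$; it lies over $\mathcal E$ by taking $X$. Its fibre over $X$ is the slice $\mathcal I_{/X}$, which lies over $(\mathcal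 E_{/X})^\to$. Let $Q\colon\mathcal E^\to_{/\mathcal E}\times_{\mathcal E}\mathcal E^\to\to\mathcal E^\to_{/\mathcal E}$ be the functor sending an arrow $f\colon A\to B$ over $D$ and an arrow $h\colon C\to D$ to the arrow $h^*f\colon A\times_DC\to B\times_DC$ over $C$. Given $u\colon\mathcal I\to\mathcal E^\to$, $v\colon\mathcal J\to\mathcal E^\to$, $w\colon\mathcal K\to\mathcal E^\to$, the triple $(\mathcal I,\mathcal J,\mathcal K)$ satisfies the *generalized functorial Frobenius condition* if $Q$ lifts to a functor $\mathcal I_{/\mathcal E}\times_{\mathcal E}\mathcal J\to\mathcal K_{/\mathcal E}$, where $\mathcal J$ lies over $\mathcal E$ by codomains. * Given $u,v,w$ as before, the triple $(\mathcal I,\mathcal J,\mathcal K)$ satisfies the *pushforward condition* if one can choose, for every $j\in\mathcal J$ with $v_j\colon C_j\to D_j$, a lift $\widetilde{(v_j)_*}\colon(\mathcal K^{\pitchfork})_{/C_j}\to(\mathcal I^{\pitchfork})_{/D_j}$ of $(v_j)_*\colon(\mathcal E_{/C_j})^\to\to(\mathcal E_{/D_j})^\to$, in such a way that for every $\tau\colon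 j\to k$ in $\mathcal J$, with $v_\tau=(s\colon C_j\to C_k,\ t\colon D_j\to D_k)$, the canonical natural transformation $\psi\colon t^*(v_k)_*\to(v_j)_*s^*$ (the mate of the canonical $s_!\,v_j^*\to v_k^*\,t_!$) lifts to a natural transformation $\widetilde{t^*}\,\widetilde{(v_k)_*}\to\widetilde{(v_j)_*}\,\widetilde{s^*}$. Here $\widetilde{s^*}\colon(\mathcal K^{\pitchfork})_{/C_k}\to(\mathcal K^{\pitchfork})_{/C_j}$ and $\widetilde{t^*}\colon(\mathcal I^{\pitchfork})_{/D_k}\to(\mathcal I^{\pitchfork})_{/D_j}$ are the lifts of $s^*$, $t^*$ that equip a pulled-back arrow with the unique fillers for which the projection is a morphism of right maps. **Theorem.** Let $(\mathsf L,\mathsf R)$ be an awfs on $\mathcal E$ that is algebraically free on $u\colon\mathcal I\to\mathcal E^\to$. Then the following are equivalent: 1. $(\mathsf L,\mathsf R)$ satisfies the functorial Frobenius condition; 2. $(\mathcal I,\ \mathsf R\text{-}\mathbf{Alg},\ \mathsf L\text{-}\mathbf{coalg})$ satisfies the generalized functorial Frobenius condition; 3. $(\mathcal I,\ \mathcal I^{\pitchfork},\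 {}^{\pitchfork}(\mathcal I^{\pitchfork}))$ satisfies the generalized functorial Frobenius condition; 4. $(\mathcal I,\ \mathsf R\text{-}\mathbf{Alg},\ \mathcal I)$ satisfies the pushforward condition; 5. $(\mathcal I,\ \mathcal I^{\pitchfork},\ \mathcal I)$ satisfies the pushforward condition. -/

import Mathlib

open CategoryTheory CategoryTheory.Limits

universe v u v₁ u₁ v₂ u₂ v₃ u₃ v₄ u₄

namespace AlgFrobenius

/-! ### Lifts of functors and of natural transformations -/

section Lifts

variable {A : Type u₁} [Category.{v₁} A] {B : Type u₂} [Category.{v₂} B]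
  {C : Type u₃} [Category.{v₃} C] {D : Type u₄} [Category.{v₄} D]

/-- `F' : A ⥤ B` is a lift of `F : C ⥤ D` along `p : A ⥤ C` and `q : B ⥤ D`:
the square `F' ⋙ q = p ⋙ F` commutes (strictly). -/
def IsLift (p : A ⥤ C) (q : B ⥤ D) (F : C ⥤ D) (F' : A ⥤ B) : Prop :=
  F' ⋙ q = p ⋙ F

/-- `F : C ⥤ D` lifts along `p : A ⥤ C` and `q : B ⥤ D`. -/
def HasLift (p : A ⥤ C) (q : B ⥤ D) (F : C ⥤ D) : Prop :=
  ∃ F' : A ⥤ B, IsLift p q F F'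

/-- Given lifts `F'`, `G'` of `F`, `G`, the natural transformation `m : F ⟶ G` lifts to a natural
transformation `F' ⟶ G'`. -/
def LiftsNatTrans {p : A ⥤ C} {q : B ⥤ D} {F G : C ⥤ D} {F' G' : A ⥤ B}
    (hF : IsLift p q F F') (hG : IsLift p q G G') (m : F ⟶ G) : Prop :=
  ∃ m' : F' ⟶ G',
    Functor.whiskerRight m' q = eqToHom hF ≫ Functor.whiskerLeft p m ≫ eqToHom hG.symm

/-- Lifts compose; stated for functors between arrow categories induced by functors between the
base categories. -/
lemma IsLift.comp_mapArrow {A' : Type*} [Category* A'] {X Y Z : Type*} [Category* X] [Category* Y]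
    [Category* Z] {p : A ⥤ Arrow X} {q : B ⥤ Arrow Y} {r : A' ⥤ Arrow Z} {F : X ⥤ Y} {G : Y ⥤ Z}
    {F' : A ⥤ B} {G' : B ⥤ A'} (hF : IsLift p q F.mapArrow F') (hG : IsLift q r G.mapArrow G') :
    IsLift p r (F ⋙ G).mapArrow (F' ⋙ G') := by
  unfold IsLift at *
  calc (F' ⋙ G') ⋙ r = F' ⋙ (G' ⋙ r) := rfl
    _ = (F' ⋙ q) ⋙ G.mapArrow := by rw [hG]; rfl
    _ = p ⋙ (F ⋙ G).mapArrow := by rw [hF]; rfl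

end Lifts

/-! ### Strict pullbacks of categories -/

section StrictPullback

variable {A : Type u₁} [Category.{v₁} A] {B : Type u₂} [Category.{v₂} B]
  {C : Type u₃} [Category.{v₃} C]

/-- Objects of the (strict) pullback `A ×_C B` of categories. -/
structure StrictPullback (F : A ⥤ C) (G : B ⥤ C) where
  fst : A
  snd : B
  w : F.obj fst = G.obj snd

namespace StrictPullback

variable {F : A ⥤ C} {G : B ⥤ C}

/-- A morphism of `A ×_C B`: a pair of morphisms with the same image in `C`. -/
@[ext]
structure Hom (x y : StrictPullback F G) where
  fst : x.fst ⟶ y.fst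
  snd : x.snd ⟶ y.snd
  w : F.map fst ≫ eqToHom y.w = eqToHom x.w ≫ G.map snd

instance : Category (StrictPullback F G) where
  Hom := Hom
  id _ := ⟨𝟙 _, 𝟙 _, by simp⟩
  comp f g := ⟨f.fst ≫ g.fst, f.snd ≫ g.snd, by
    rw [Functor.map_comp, Category.assoc, g.w, ← Category.assoc, f.w, Category.assoc,
      Functor.map_comp]⟩
  id_comp f := Hom.ext (Category.id_comp _) (Category.id_comp _)
  comp_id f := Hom.ext (Category.comp_id _) (Category.comp_id _)
  assoc f g h := Hom.ext (Category.assoc _ _ _) (Category.assoc _ _ _)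

variable {A' : Type u₃} [Category.{v₃} A'] {B' : Type u₄} [Category.{v₄} B']
  {E : Type u} [Category.{v} E]

/-- The functor `a ×_E b : A ×_E B ⥤ A' ×_E B'` induced by `a : A ⥤ A'` and `b : B ⥤ B'`. -/
def map (a : A ⥤ A') (b : B ⥤ B') (F : A' ⥤ E) (G : B' ⥤ E) :
    StrictPullback (a ⋙ F) (b ⋙ G) ⥤ StrictPullback F G where
  obj x := ⟨a.obj x.fst, b.obj x.snd, x.w⟩
  map f := ⟨a.map f.fst, b.map f.snd, f.w⟩
  map_id _ := Hom.ext (a.map_id _) (b.map_id _)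
  map_comp _ _ := Hom.ext (a.map_comp _ _) (b.map_comp _ _)

end StrictPullback

end StrictPullback

variable {E : Type u} [Category.{v} E]

/-! ### Categories of orthogonal maps -/

section Orthogonal

variable {I : Type u₁} [Category.{v₁} I]

/-- A right `I`-map for `u : I ⥤ E^→`: an arrow `f` of `E` with a choice of diagonal filler for
every commutative square from some `u i` to `f`, natural in `i`. -/
structure RightMap (u : I ⥤ Arrow E) where
  arrow : Arrow E
  fill (i : I) (sq : u.obj i ⟶ arrow) : (u.obj i).right ⟶ arrow.left
  hom_fill (i : I) (sq : u.obj i ⟶ arrow) : (u.obj i).hom ≫ fill i sq = sq.left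
  fill_hom (i : I) (sq : u.obj i ⟶ arrow) : fill i sq ≫ arrow.hom = sq.right
  natural {i j : I} (σ : i ⟶ j) (sq : u.obj j ⟶ arrow) :
    (u.map σ).right ≫ fill j sq = fill i (u.map σ ≫ sq)

/-- A left `I`-map for `u : I ⥤ E^→`: an arrow `f` of `E` with a choice of diagonal filler for
every commutative square from `f` to some `u i`, natural in `i`. -/
structure LeftMap (u : I ⥤ Arrow E) where
  arrow : Arrow E
  fill (i : I) (sq : arrow ⟶ u.obj i) : arrow.right ⟶ (u.obj i).left
  hom_fill (i : I) (sq : arrow ⟶ u.obj i) : arrow.hom ≫ fill i sq = sq.left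
  fill_hom (i : I) (sq : arrow ⟶ u.obj i) : fill i sq ≫ (u.obj i).hom = sq.right
  natural {i j : I} (σ : i ⟶ j) (sq : arrow ⟶ u.obj i) :
    fill i sq ≫ (u.map σ).left = fill j (sq ≫ u.map σ)

namespace RightMap

variable {u : I ⥤ Arrow E}

/-- A morphism of right `I`-maps: a square compatible with the chosen fillers. -/
@[ext]
structure Hom (f g : RightMap u) where
  sq : f.arrow ⟶ g.arrow
  fill_comp (i : I) (s : u.obj i ⟶ f.arrow) : f.fill i s ≫ sq.left = g.fill i (s ≫ sq)

instance : Category (RightMap u) where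
  Hom := Hom
  id f := ⟨𝟙 _, fun i s => by simp⟩
  comp a b := ⟨a.sq ≫ b.sq, fun i s => by
    rw [Arrow.comp_left, ← Category.assoc, a.fill_comp, b.fill_comp, Category.assoc]⟩
  id_comp a := Hom.ext (Category.id_comp _)
  comp_id a := Hom.ext (Category.comp_id _)
  assoc a b c := Hom.ext (Category.assoc _ _ _)

variable (u) in
/-- The right orthogonal `I^⋔ ⥤ E^→` of `u : I ⥤ E^→`. -/
abbrev forget : RightMap u ⥤ Arrow E where
  obj f := f.arrow
  map a := a.sq

end RightMap

namespace LeftMap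

variable {u : I ⥤ Arrow E}

/-- A morphism of left `I`-maps: a square compatible with the chosen fillers. -/
@[ext]
structure Hom (f g : LeftMap u) where
  sq : f.arrow ⟶ g.arrow
  comp_fill (i : I) (s : g.arrow ⟶ u.obj i) : sq.right ≫ g.fill i s = f.fill i (sq ≫ s)

instance : Category (LeftMap u) where
  Hom := Hom
  id f := ⟨𝟙 _, fun i s => by simp⟩
  comp a b := ⟨a.sq ≫ b.sq, fun i s => by
    rw [Arrow.comp_right, Category.assoc, b.comp_fill, a.comp_fill, Category.assoc]⟩
  id_comp a := Hom.ext (Category.id_comp _)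
  comp_id a := Hom.ext (Category.comp_id _)
  assoc a b c := Hom.ext (Category.assoc _ _ _)

variable (u) in
/-- The left orthogonal `^⋔I ⥤ E^→` of `u : I ⥤ E^→`. -/
abbrev forget : LeftMap u ⥤ Arrow E where
  obj f := f.arrow
  map a := a.sq

end LeftMap

end Orthogonal

/-! ### Functorial factorizations and algebraic weak factorization systems -/

variable (E) in
/-- A functorial factorization `f = Lf ≫ Rf` on `E`, with no condition on the two factors. -/
abbrev FunctorialFactorization :=
  MorphismProperty.FunctorialFactorizationData (⊤ : MorphismProperty E) (⊤ : MorphismProperty E)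

namespace FunctorialFactorization

variable (F : FunctorialFactorization E)

/-- The functor `L : E^→ ⥤ E^→` sending `f` to its left factor. -/
def L : Arrow E ⥤ Arrow E where
  obj f := Arrow.mk (F.i.app f)
  map {f g} a := Arrow.homMk a.left (F.Z.map a) (F.i.naturality a)
  map_id f := Arrow.hom_ext _ _ rfl (F.Z.map_id f)
  map_comp a b := Arrow.hom_ext _ _ rfl (F.Z.map_comp a b)

/-- The functor `R : E^→ ⥤ E^→` sending `f` to its right factor. -/
def R : Arrow E ⥤ Arrow E where
  obj f := Arrow.mk (F.p.app f)
  map {f g} a := Arrow.homMk (F.Z.map a) a.right (F.p.naturality a)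
  map_id f := Arrow.hom_ext _ _ (F.Z.map_id f) rfl
  map_comp a b := Arrow.hom_ext _ _ (F.Z.map_comp a b) rfl

/-- The canonical copointing `L ⟶ Id`, with components `(id, Rf)`. -/
def ε : F.L ⟶ 𝟭 (Arrow E) where
  app f := Arrow.homMk (𝟙 f.left) (F.p.app f)
    ((Category.id_comp _).trans (F.fac_app (f := f)).symm)
  naturality _ _ a := by
    ext
    · exact (Category.comp_id _).trans (Category.id_comp _).symm
    · exact F.p.naturality a

/-- The canonical pointing `Id ⟶ R`, with components `(Lf, id)`. -/
def η : 𝟭 (Arrow E) ⟶ F.R where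
  app f := Arrow.homMk (F.i.app f) (𝟙 f.right)
    ((F.fac_app (f := f)).trans (Category.comp_id _).symm)
  naturality _ _ a := by
    ext
    · exact F.i.naturality a
    · exact (Category.comp_id _).trans (Category.id_comp _).symm

end FunctorialFactorization

/-- `Δ : LR ⟶ RL` is a distributive law of the comonad `L` over the monad `R` (both on `C`):
compatibility with counit, unit, comultiplication and multiplication. Recall that `R ⋙ L` is the
composite `f ↦ L (R f)`. -/
structure IsDistributiveLaw {C : Type u₁} [Category.{v₁} C] (L : Comonad C) (R : Monad C)
    (Δ : R.toFunctor ⋙ L.toFunctor ⟶ L.toFunctor ⋙ R.toFunctor) : Prop where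
  counit (f : C) : Δ.app f ≫ R.map (L.ε.app f) = L.ε.app (R.obj f)
  unit (f : C) : L.map (R.η.app f) ≫ Δ.app f = R.η.app (L.obj f)
  comul (f : C) :
    L.δ.app (R.obj f) ≫ L.map (Δ.app f) ≫ Δ.app (L.obj f) = Δ.app f ≫ R.map (L.δ.app f)
  mul (f : C) :
    L.map (R.μ.app f) ≫ Δ.app f = Δ.app (R.obj f) ≫ R.map (Δ.app f) ≫ R.μ.app (L.obj f)

variable (E) in
/-- A functorial factorization together with a comultiplication making `(L, ε)` a comonad and a
multiplication making `(R, η)` a monad. -/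
structure PreAWFS where
  F : FunctorialFactorization E
  δ : F.L ⟶ F.L ⋙ F.L
  coassoc (f : Arrow E) : δ.app f ≫ F.L.map (δ.app f) = δ.app f ≫ δ.app (F.L.obj f)
  left_counit (f : Arrow E) : δ.app f ≫ F.ε.app (F.L.obj f) = 𝟙 (F.L.obj f)
  right_counit (f : Arrow E) : δ.app f ≫ F.L.map (F.ε.app f) = 𝟙 (F.L.obj f)
  μ : F.R ⋙ F.R ⟶ F.R
  assoc (f : Arrow E) : F.R.map (μ.app f) ≫ μ.app f = μ.app (F.R.obj f) ≫ μ.app f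
  left_unit (f : Arrow E) : F.η.app (F.R.obj f) ≫ μ.app f = 𝟙 (F.R.obj f)
  right_unit (f : Arrow E) : F.R.map (F.η.app f) ≫ μ.app f = 𝟙 (F.R.obj f)

namespace PreAWFS

variable (A : PreAWFS E)

/-- The comonad `L`. -/
def comonad : Comonad (Arrow E) where
  toFunctor := A.F.L
  ε := A.F.ε
  δ := A.δ
  coassoc := A.coassoc
  left_counit := A.left_counit
  right_counit := A.right_counit

/-- The monad `R`. -/
def monad : Monad (Arrow E) where
  toFunctor := A.F.R
  η := A.F.η
  μ := A.μ
  assoc := A.assoc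
  left_unit := A.left_unit
  right_unit := A.right_unit

lemma δ_left (f : Arrow E) : (A.δ.app f).left = 𝟙 f.left := by
  have h : (A.δ.app f).left ≫ 𝟙 f.left = 𝟙 f.left := congrArg (fun z => Arrow.Hom.left z) (A.left_counit f)
  exact (Category.comp_id _).symm.trans h

lemma μ_right (f : Arrow E) : (A.μ.app f).right = 𝟙 f.right := by
  have h : 𝟙 f.right ≫ (A.μ.app f).right = 𝟙 f.right := congrArg (fun z => Arrow.Hom.right z) (A.left_unit f)
  exact (Category.id_comp _).symm.trans h

/-- The canonical natural transformation `LR ⟶ RL`. Writing `f = Lf ≫ Rf` with middle object `Mf`,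
its component at `f` is the square from `LRf : Mf ⟶ MRf` to `RLf : MLf ⟶ Mf` whose sides are the
nontrivial parts `Mf ⟶ MLf` of the comultiplication and `MRf ⟶ Mf` of the multiplication. -/
def distrib : A.F.R ⋙ A.F.L ⟶ A.F.L ⋙ A.F.R where
  app f := Arrow.homMk (A.δ.app f).right (A.μ.app f).left (by
    have h₁ : (A.δ.app f).right ≫ A.F.p.app (A.F.L.obj f) = 𝟙 (A.F.Z.obj f) :=
      congrArg (fun z => Arrow.Hom.right z) (A.left_counit f)
    have h₂ : A.F.i.app (A.F.R.obj f) ≫ (A.μ.app f).left = 𝟙 (A.F.Z.obj f) :=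
      congrArg (fun z => Arrow.Hom.left z) (A.left_unit f)
    exact h₁.trans h₂.symm)
  naturality _ _ a := by
    ext
    · exact congrArg (fun z => Arrow.Hom.right z) (A.δ.naturality a)
    · exact congrArg (fun z => Arrow.Hom.left z) (A.μ.naturality a)

end PreAWFS

variable (E) in
/-- An algebraic weak factorization system on `E`. -/
structure AWFS extends PreAWFS E where
  isDistributiveLaw : IsDistributiveLaw toPreAWFS.comonad toPreAWFS.monad toPreAWFS.distrib

namespace AWFS

variable (A : AWFS E)

/-- `L-coalg`: coalgebras for the copointed endofunctor `(L, ε)`. -/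
abbrev Lcoalg :=
  ObjectProperty.FullSubcategory (C := Endofunctor.Coalgebra A.F.L)
    fun c => c.str ≫ A.F.ε.app c.V = 𝟙 c.V

/-- `R-alg`: algebras for the pointed endofunctor `(R, η)`. -/
abbrev Ralg :=
  ObjectProperty.FullSubcategory (C := Endofunctor.Algebra A.F.R)
    fun a => A.F.η.app a.a ≫ a.str = 𝟙 a.a

/-- `R-Alg`: algebras for the monad `R`. -/
abbrev RAlg := A.monad.Algebra

/-- The forgetful functor `L-coalg ⥤ E^→`. -/
def LcoalgForget : A.Lcoalg ⥤ Arrow E :=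
  ObjectProperty.ι _ ⋙ Endofunctor.Coalgebra.forget A.F.L

/-- The forgetful functor `R-alg ⥤ E^→`. -/
def RalgForget : A.Ralg ⥤ Arrow E :=
  ObjectProperty.ι _ ⋙ Endofunctor.Algebra.forget A.F.R

/-- The forgetful functor `R-Alg ⥤ E^→`. -/
def RAlgForget : A.RAlg ⥤ Arrow E := A.monad.forget

/-- The awfs is algebraically free on `u : I ⥤ E^→`: there is an isomorphism of categories
`R-Alg ≅ I^⋔` over `E^→`. -/
def IsAlgebraicallyFreeOn {I : Type u₁} [Category.{v₁} I] (u : I ⥤ Arrow E) : Prop :=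
  ∃ (Φ : A.RAlg ⥤ RightMap u) (Ψ : RightMap u ⥤ A.RAlg),
    Φ ⋙ Ψ = 𝟭 _ ∧ Ψ ⋙ Φ = 𝟭 _ ∧ Φ ⋙ RightMap.forget u = A.RAlgForget

end AWFS

/-! ### Auxiliary facts on maps between pullbacks -/

section PullbackMaps

variable {X Y Z X' Y' Z' X₁ Y₁ Z₁ X₂ Y₂ Z₂ : E} {f : X ⟶ Z} {g : Y ⟶ Z} {f' : X' ⟶ Z'}
  {g' : Y' ⟶ Z'} {f₁ : X₁ ⟶ Z₁} {g₁ : Y₁ ⟶ Z₁} {f₂ : X₂ ⟶ Z₂} {g₂ : Y₂ ⟶ Z₂}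
  [HasPullback f g] [HasPullback f' g'] [HasPullback f₁ g₁] [HasPullback f₂ g₂]

lemma lift_comp_lift {a : X ⟶ X₁} {a' : X₁ ⟶ X'} {b : Y ⟶ Y₁} {b' : Y₁ ⟶ Y'} {c : X ⟶ X'}
    {d : Y ⟶ Y'} (hc : a ≫ a' = c) (hd : b ≫ b' = d)
    (w : (pullback.fst f g ≫ a) ≫ f₁ = (pullback.snd f g ≫ b) ≫ g₁)
    (w' : (pullback.fst f₁ g₁ ≫ a') ≫ f' = (pullback.snd f₁ g₁ ≫ b') ≫ g')
    (w'' : (pullback.fst f g ≫ c) ≫ f' = (pullback.snd f g ≫ d) ≫ g') :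
    pullback.lift (pullback.fst f g ≫ c) (pullback.snd f g ≫ d) w'' =
    pullback.lift (pullback.fst f g ≫ a) (pullback.snd f g ≫ b) w ≫
      pullback.lift (pullback.fst f₁ g₁ ≫ a') (pullback.snd f₁ g₁ ≫ b') w' := by
  subst hc hd
  apply pullback.hom_ext
  · rw [Category.assoc, pullback.lift_fst, pullback.lift_fst, pullback.lift_fst_assoc,
      Category.assoc]
  · rw [Category.assoc, pullback.lift_snd, pullback.lift_snd, pullback.lift_snd_assoc,
      Category.assoc]

lemma lift_comp_lift_eq {a : X ⟶ X₁} {a' : X₁ ⟶ X'} {b : Y ⟶ Y₁} {b' : Y₁ ⟶ Y'} {c : X ⟶ X₂}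
    {c' : X₂ ⟶ X'} {d : Y ⟶ Y₂} {d' : Y₂ ⟶ Y'} (hc : a ≫ a' = c ≫ c') (hd : b ≫ b' = d ≫ d')
    (w : (pullback.fst f g ≫ a) ≫ f₁ = (pullback.snd f g ≫ b) ≫ g₁)
    (w₁ : (pullback.fst f₁ g₁ ≫ a') ≫ f' = (pullback.snd f₁ g₁ ≫ b') ≫ g')
    (w' : (pullback.fst f g ≫ c) ≫ f₂ = (pullback.snd f g ≫ d) ≫ g₂)
    (w₂ : (pullback.fst f₂ g₂ ≫ c') ≫ f' = (pullback.snd f₂ g₂ ≫ d') ≫ g') :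
    pullback.lift (pullback.fst f g ≫ a) (pullback.snd f g ≫ b) w ≫
      pullback.lift (pullback.fst f₁ g₁ ≫ a') (pullback.snd f₁ g₁ ≫ b') w₁ =
    pullback.lift (pullback.fst f g ≫ c) (pullback.snd f g ≫ d) w' ≫
      pullback.lift (pullback.fst f₂ g₂ ≫ c') (pullback.snd f₂ g₂ ≫ d') w₂ := by
  have w₀ : (pullback.fst f g ≫ a ≫ a') ≫ f' = (pullback.snd f g ≫ b ≫ b') ≫ g' := by
    have h := pullback.lift (pullback.fst f g ≫ a) (pullback.snd f g ≫ b) w ≫= w₁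
    rw [Category.assoc, Category.assoc, pullback.lift_fst_assoc, pullback.lift_snd_assoc] at h
    simpa only [Category.assoc] using h
  exact (lift_comp_lift rfl rfl w w₁ w₀).symm.trans (lift_comp_lift hc.symm hd.symm w' w₂ w₀)

end PullbackMaps

/-! ### The functorial Frobenius condition -/

section Frobenius

variable (E) in
/-- The category `E^→ ×_E E^→` of cospans in `E`. -/
abbrev Cospans := StrictPullback (Arrow.rightFunc (C := E)) (Arrow.rightFunc (C := E))

/-- The first leg of a cospan, as an arrow into the codomain of the second leg. -/
def Cospans.leg (x : Cospans E) : x.fst.left ⟶ x.snd.right :=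
  x.fst.hom ≫ eqToHom (show x.fst.right = x.snd.right from x.w)

lemma Cospans.leg_w {x y : Cospans E} (α : x ⟶ y) :
    x.leg ≫ α.snd.right = α.fst.left ≫ y.leg := by
  have h : α.fst.right ≫ eqToHom (show y.fst.right = y.snd.right from y.w) =
      eqToHom (show x.fst.right = x.snd.right from x.w) ≫ α.snd.right := α.w
  have h' : α.fst.left ≫ y.fst.hom = x.fst.hom ≫ α.fst.right := Arrow.w α.fst
  rw [Cospans.leg, Cospans.leg, Category.assoc, ← h, reassoc_of% h']

variable [HasPullbacks E]

/-- The pullback functor `P : E^→ ×_E E^→ ⥤ E^→`, sending a cospan `(g, h)` to `h^* g`. -/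
noncomputable def pullbackP : Cospans E ⥤ Arrow E where
  obj x := Arrow.mk (pullback.snd x.leg x.snd.hom)
  map {x y} α := Arrow.homMk
    (pullback.map x.leg x.snd.hom y.leg y.snd.hom α.fst.left α.snd.left α.snd.right
      (Cospans.leg_w α) (Arrow.w α.snd).symm)
    α.snd.left (pullback.lift_snd _ _ _)
  map_id _ := Arrow.hom_ext _ _ pullback.map_id rfl
  map_comp _ _ := Arrow.hom_ext _ _ (lift_comp_lift rfl rfl _ _ _) rfl

/-- The functorial Frobenius condition for an awfs: `P` lifts to a functor
`L-coalg ×_E R-alg ⥤ L-coalg`. -/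
def AWFS.FunctorialFrobenius (A : AWFS E) : Prop :=
  HasLift (StrictPullback.map A.LcoalgForget A.RalgForget Arrow.rightFunc Arrow.rightFunc)
    A.LcoalgForget pullbackP

end Frobenius

/-! ### Slices and the generalized functorial Frobenius condition -/

section Triangles

variable {I : Type u₁} [Category.{v₁} I] {B : Type u₂} [Category.{v₂} B]

/-- Objects of `I_{/E} ×_E B` for `u : I ⥤ E^→` and `s : B ⥤ E`: an object `x` of `B`, an object
`i` of `I`, and a commutative triangle from `u i : A_i ⟶ B_i` to `s x`.
For `s = 𝟭 E` this is `I_{/E}`. -/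
structure Triangle (u : I ⥤ Arrow E) (s : B ⥤ E) where
  base : B
  i : I
  a : (u.obj i).left ⟶ s.obj base
  b : (u.obj i).right ⟶ s.obj base
  w : (u.obj i).hom ≫ b = a

namespace Triangle

variable {u : I ⥤ Arrow E} {s : B ⥤ E}

/-- A morphism of `I_{/E} ×_E B`; compatibility with the maps `a` is automatic. -/
@[ext]
structure Hom (x y : Triangle u s) where
  base : x.base ⟶ y.base
  i : x.i ⟶ y.i
  w : (u.map i).right ≫ y.b = x.b ≫ s.map base

instance : Category (Triangle u s) where
  Hom := Hom
  id _ := ⟨𝟙 _, 𝟙 _, by simp⟩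
  comp f g := ⟨f.base ≫ g.base, f.i ≫ g.i, by
    rw [Functor.map_comp, Arrow.comp_right, Category.assoc, g.w, ← Category.assoc, f.w,
      Category.assoc, Functor.map_comp]⟩
  id_comp f := Hom.ext (Category.id_comp _) (Category.id_comp _)
  comp_id f := Hom.ext (Category.comp_id _) (Category.comp_id _)
  assoc f g h := Hom.ext (Category.assoc _ _ _) (Category.assoc _ _ _)

/-- The functor `u_{/E} : I_{/E} ⥤ E^→_{/E}`. -/
def total (u : I ⥤ Arrow E) : Triangle u (𝟭 E) ⥤ Triangle (𝟭 (Arrow E)) (𝟭 E) where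
  obj x := ⟨x.base, u.obj x.i, x.a, x.b, x.w⟩
  map f := ⟨f.base, u.map f.i, f.w⟩
  map_id _ := Hom.ext rfl (u.map_id _)
  map_comp _ _ := Hom.ext rfl (u.map_comp _ _)

/-- The functor `u_{/E} ×_E v : I_{/E} ×_E J ⥤ E^→_{/E} ×_E E^→`, the categories `J` and `E^→`
lying over `E` by taking codomains. -/
def prod {J : Type u₂} [Category.{v₂} J] (u : I ⥤ Arrow E) (v : J ⥤ Arrow E) :
    Triangle u (v ⋙ Arrow.rightFunc) ⥤ Triangle (𝟭 (Arrow E)) (Arrow.rightFunc (C := E)) where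
  obj x := ⟨v.obj x.base, u.obj x.i, x.a, x.b, x.w⟩
  map f := ⟨v.map f.base, u.map f.i, f.w⟩
  map_id _ := Hom.ext (v.map_id _) (u.map_id _)
  map_comp _ _ := Hom.ext (v.map_comp _ _) (u.map_comp _ _)

lemma Hom.w_left {x y : Triangle u s} (f : x ⟶ y) :
    (u.map f.i).left ≫ y.a = x.a ≫ s.map f.base := by
  have h₁ : (u.map f.i).left ≫ (u.obj y.i).hom = (u.obj x.i).hom ≫ (u.map f.i).right :=
    Arrow.w (u.map f.i)
  have h₂ : (u.map f.i).right ≫ y.b = x.b ≫ s.map f.base := f.w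
  rw [← x.w, ← y.w, reassoc_of% h₁, h₂, Category.assoc]

end Triangle

variable [HasPullbacks E]

/-- The pullback functor `Q : E^→_{/E} ×_E E^→ ⥤ E^→_{/E}`: it sends an arrow `f : A ⟶ B` over `D`
and an arrow `h : C ⟶ D` to the arrow `h^* f : A ×_D C ⟶ B ×_D C` over `C`. -/
noncomputable def pullbackQ :
    Triangle (𝟭 (Arrow E)) (Arrow.rightFunc (C := E)) ⥤ Triangle (𝟭 (Arrow E)) (𝟭 E) where
  obj x :=
    { base := x.base.left
      i := Arrow.mk (pullback.map x.a x.base.hom x.b x.base.hom x.i.hom (𝟙 _) (𝟙 _)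
        ((Category.comp_id _).trans x.w.symm) ((Category.comp_id _).trans (Category.id_comp _).symm))
      a := pullback.snd x.a x.base.hom
      b := pullback.snd x.b x.base.hom
      w := (pullback.lift_snd _ _ _).trans (Category.comp_id _) }
  map {x y} α :=
    { base := α.base.left
      i := Arrow.homMk
        (pullback.map x.a x.base.hom y.a y.base.hom α.i.left α.base.left α.base.right
          α.w_left.symm (Arrow.w α.base).symm)
        (pullback.map x.b x.base.hom y.b y.base.hom α.i.right α.base.left α.base.right
          α.w.symm (Arrow.w α.base).symm)
        (lift_comp_lift_eq (Arrow.w α.i) ((Category.comp_id _).trans (Category.id_comp _).symm)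
          _ _ _ _)
      w := pullback.lift_snd _ _ _ }
  map_id _ := Triangle.Hom.ext rfl (Arrow.hom_ext _ _ pullback.map_id pullback.map_id)
  map_comp _ _ := Triangle.Hom.ext rfl (Arrow.hom_ext _ _
    (lift_comp_lift rfl rfl _ _ _) (lift_comp_lift rfl rfl _ _ _))

/-- The generalized functorial Frobenius condition for `u : I ⥤ E^→`, `v : J ⥤ E^→`,
`w : K ⥤ E^→`: `Q` lifts to a functor `I_{/E} ×_E J ⥤ K_{/E}`. -/
def GeneralizedFrobenius {J : Type u₂} [Category.{v₂} J] {K : Type u₃} [Category.{v₃} K]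
    (u : I ⥤ Arrow E) (v : J ⥤ Arrow E) (w : K ⥤ Arrow E) : Prop :=
  HasLift (Triangle.prod u v) (Triangle.total w) pullbackQ

end Triangles

/-! ### Lifting pushforward functors, with Beck–Chevalley coherence -/

section Pushforward

variable {I : Type u₁} [Category.{v₁} I]

/-- Objects of the slice `I_{/X}` of `u : I ⥤ E^→` over `X`. -/
structure Slice (u : I ⥤ Arrow E) (X : E) where
  i : I
  a : (u.obj i).left ⟶ X
  b : (u.obj i).right ⟶ X
  w : (u.obj i).hom ≫ b = a

namespace Slice

variable {u : I ⥤ Arrow E} {X : E}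

/-- A morphism of `I_{/X}`; compatibility with the maps `a` is automatic. -/
@[ext]
structure Hom (x y : Slice u X) where
  i : x.i ⟶ y.i
  w : (u.map i).right ≫ y.b = x.b

instance : Category (Slice u X) where
  Hom := Hom
  id x := ⟨𝟙 _, by simp⟩
  comp f g := ⟨f.i ≫ g.i, by
    rw [Functor.map_comp, Arrow.comp_right, Category.assoc, g.w, f.w]⟩
  id_comp f := Hom.ext (Category.id_comp _)
  comp_id f := Hom.ext (Category.comp_id _)
  assoc f g h := Hom.ext (Category.assoc _ _ _)

lemma Hom.w_left {x y : Slice u X} (f : x ⟶ y) : (u.map f.i).left ≫ y.a = x.a := by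
  have h₁ : (u.map f.i).left ≫ (u.obj y.i).hom = (u.obj x.i).hom ≫ (u.map f.i).right :=
    Arrow.w (u.map f.i)
  have h₂ : (u.map f.i).right ≫ y.b = x.b := f.w
  rw [← x.w, ← y.w, reassoc_of% h₁, h₂]

variable (u X) in
/-- The functor `u_{/X} : I_{/X} ⥤ (E_{/X})^→`. -/
def toOver : Slice u X ⥤ Arrow (Over X) where
  obj x := Arrow.mk (Over.homMk (u.obj x.i).hom x.w : Over.mk x.a ⟶ Over.mk x.b)
  map {x y} f := Arrow.homMk (Over.homMk (u.map f.i).left (Hom.w_left f))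
    (Over.homMk (u.map f.i).right f.w) (by ext; exact Arrow.w (u.map f.i))
  map_id x := Arrow.hom_ext _ _
    (Over.OverMorphism.ext (Arrow.hom.congr_left (u.map_id x.i)))
    (Over.OverMorphism.ext (Arrow.hom.congr_right (u.map_id x.i)))
  map_comp f g := Arrow.hom_ext _ _
    (Over.OverMorphism.ext (Arrow.hom.congr_left (u.map_comp f.i g.i)))
    (Over.OverMorphism.ext (Arrow.hom.congr_right (u.map_comp f.i g.i)))

end Slice

variable [HasPullbacks E]

/-- For a morphism `p : A ⟶ A'` over `Y` and `h : X ⟶ Y`, the morphism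
`h^* p : A ×_Y X ⟶ A' ×_Y X`. -/
noncomputable def baseChange {A A' X Y : E} {a : A ⟶ Y} {a' : A' ⟶ Y} (p : A ⟶ A') (w : p ≫ a' = a)
    (h : X ⟶ Y) : pullback a h ⟶ pullback a' h :=
  pullback.lift (pullback.fst a h ≫ p) (pullback.snd a h)
    (by rw [Category.assoc, w, pullback.condition])

section

variable {A A' A'' X Y : E} {a : A ⟶ Y} {a' : A' ⟶ Y} {a'' : A'' ⟶ Y}

lemma baseChange_fst (p : A ⟶ A') (w : p ≫ a' = a) (h : X ⟶ Y) :
    baseChange p w h ≫ pullback.fst a' h = pullback.fst a h ≫ p :=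
  pullback.lift_fst _ _ _

lemma baseChange_snd (p : A ⟶ A') (w : p ≫ a' = a) (h : X ⟶ Y) :
    baseChange p w h ≫ pullback.snd a' h = pullback.snd a h :=
  pullback.lift_snd _ _ _

lemma baseChange_id (w : 𝟙 A ≫ a = a) (h : X ⟶ Y) : baseChange (𝟙 A) w h = 𝟙 (pullback a h) := by
  apply pullback.hom_ext
  · rw [baseChange_fst, Category.comp_id, Category.id_comp]
  · rw [baseChange_snd, Category.id_comp]

lemma baseChange_comp {p : A ⟶ A'} (w : p ≫ a' = a) {q : A' ⟶ A''} (w' : q ≫ a'' = a')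
    {r : A ⟶ A''} (w'' : r ≫ a'' = a) (hr : p ≫ q = r) (h : X ⟶ Y) :
    baseChange r w'' h = baseChange p w h ≫ baseChange q w' h := by
  subst hr
  apply pullback.hom_ext
  · rw [Category.assoc, baseChange_fst, baseChange_fst, reassoc_of% (baseChange_fst p w h)]
  · rw [Category.assoc, baseChange_snd, baseChange_snd, baseChange_snd]

end

/-- For an arrow `f : A ⟶ B` over `Y` and `h : X ⟶ Y`, the projection from
`h^* f : A ×_Y X ⟶ B ×_Y X` to `f`. -/
noncomputable abbrev baseChangeProj (f : Arrow E) {X Y : E} {a : f.left ⟶ Y} {b : f.right ⟶ Y}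
    (w : f.hom ≫ b = a) (h : X ⟶ Y) : Arrow.mk (baseChange f.hom w h) ⟶ f :=
  Arrow.homMk (pullback.fst a h) (pullback.fst b h) (baseChange_fst f.hom w h).symm

/-- The pullback of a right `I`-map `f : A ⟶ B` over `Y` along `h : X ⟶ Y`, with underlying arrow
`A ×_Y X ⟶ B ×_Y X` and the unique fillers for which the projection to `f` is a morphism of right
`I`-maps. -/
noncomputable def RightMap.pullbackAlong {u : I ⥤ Arrow E} (f : RightMap u) {X Y : E}
    {a : f.arrow.left ⟶ Y} {b : f.arrow.right ⟶ Y} (w : f.arrow.hom ≫ b = a) (h : X ⟶ Y) :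
    RightMap u where
  arrow := Arrow.mk (baseChange f.arrow.hom w h)
  fill i sq := pullback.lift (f.fill i (sq ≫ baseChangeProj f.arrow w h))
    (sq.right ≫ pullback.snd b h) (by
      have h₂ : f.fill i (sq ≫ baseChangeProj f.arrow w h) ≫ f.arrow.hom =
        sq.right ≫ pullback.fst b h := f.fill_hom i _
      refine (congrArg (_ ≫ ·) w.symm).trans ?_
      rw [reassoc_of% h₂, pullback.condition, Category.assoc])
  hom_fill i sq := by
    have h₁ : (u.obj i).hom ≫ sq.right = sq.left ≫ baseChange f.arrow.hom w h := (Arrow.w sq).symm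
    refine pullback.hom_ext (f := a) (g := h) ?_ ?_
    · rw [Category.assoc, pullback.lift_fst, f.hom_fill]
      rfl
    · rw [Category.assoc, pullback.lift_snd, reassoc_of% h₁, baseChange_snd]
  fill_hom i sq := by
    refine pullback.hom_ext (f := b) (g := h) ?_ ?_
    · refine (Category.assoc _ _ _).trans ((congrArg (_ ≫ ·) (baseChange_fst _ w h)).trans ?_)
      rw [pullback.lift_fst_assoc, f.fill_hom]
      rfl
    · refine (Category.assoc _ _ _).trans ((congrArg (_ ≫ ·) (baseChange_snd _ w h)).trans ?_)
      rw [pullback.lift_snd]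
  natural {i j} σ sq := by
    refine pullback.hom_ext (f := a) (g := h) ?_ ?_
    · rw [Category.assoc, pullback.lift_fst, pullback.lift_fst, f.natural, Category.assoc]
    · rw [Category.assoc, pullback.lift_snd, pullback.lift_snd, Arrow.comp_right, Category.assoc]

/-- The pullback of a morphism of right `I`-maps over `Y` along `h : X ⟶ Y`. -/
noncomputable def RightMap.pullbackAlongMap {u : I ⥤ Arrow E} {f f' : RightMap u} (α : f ⟶ f')
    {X Y : E} {a : f.arrow.left ⟶ Y} {b : f.arrow.right ⟶ Y} (w : f.arrow.hom ≫ b = a)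
    {a' : f'.arrow.left ⟶ Y} {b' : f'.arrow.right ⟶ Y} (w' : f'.arrow.hom ≫ b' = a')
    (ha : α.sq.left ≫ a' = a) (hb : α.sq.right ≫ b' = b) (h : X ⟶ Y) :
    f.pullbackAlong w h ⟶ f'.pullbackAlong w' h where
  sq := Arrow.homMk (f := Arrow.mk (baseChange f.arrow.hom w h))
    (g := Arrow.mk (baseChange f'.arrow.hom w' h))
    (baseChange α.sq.left ha h) (baseChange α.sq.right hb h)
    ((baseChange_comp ha w' (r := f.arrow.hom ≫ α.sq.right) (by rw [Category.assoc, hb, w])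
        (Arrow.w α.sq) h).symm.trans
      (baseChange_comp w hb _ rfl h))
  fill_comp i s := by
    refine pullback.hom_ext (f := a') (g := h) ?_ ?_
    · refine (Category.assoc _ _ _).trans ((congrArg (_ ≫ ·) (baseChange_fst _ ha h)).trans ?_)
      refine (pullback.lift_fst_assoc _ _ _ _).trans
        (Eq.trans ?_ (pullback.lift_fst _ _ _).symm)
      refine (α.fill_comp i _).trans (congrArg (f'.fill i) ?_)
      refine Arrow.hom_ext _ _ ?_ ?_
      · exact (Category.assoc _ _ _).trans ((congrArg (s.left ≫ ·)
          (baseChange_fst α.sq.left ha h).symm).trans (Category.assoc _ _ _).symm)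
      · exact (Category.assoc _ _ _).trans ((congrArg (s.right ≫ ·)
          (baseChange_fst α.sq.right hb h).symm).trans (Category.assoc _ _ _).symm)
    · refine (Category.assoc _ _ _).trans ((congrArg (_ ≫ ·) (baseChange_snd _ ha h)).trans ?_)
      refine (pullback.lift_snd _ _ _).trans (Eq.trans ?_ (pullback.lift_snd _ _ _).symm)
      exact (congrArg (s.right ≫ ·) (baseChange_snd α.sq.right hb h).symm).trans
        (Category.assoc _ _ _).symm

/-- The lift `(I^⋔)_{/Y} ⥤ (I^⋔)_{/X}` of the pullback functor along `h : X ⟶ Y`. -/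
noncomputable def pullbackSlice (u : I ⥤ Arrow E) {X Y : E} (h : X ⟶ Y) :
    Slice (RightMap.forget u) Y ⥤ Slice (RightMap.forget u) X where
  obj x :=
    { i := x.i.pullbackAlong x.w h
      a := pullback.snd x.a h
      b := pullback.snd x.b h
      w := baseChange_snd _ x.w h }
  map {x y} f :=
    { i := RightMap.pullbackAlongMap f.i x.w y.w f.w_left f.w h
      w := baseChange_snd _ f.w h }
  map_id x := Slice.Hom.ext (RightMap.Hom.ext (Arrow.hom_ext _ _
    (baseChange_id (Category.id_comp x.a) h) (baseChange_id (Category.id_comp x.b) h)))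
  map_comp f g := Slice.Hom.ext (RightMap.Hom.ext (Arrow.hom_ext _ _
    (baseChange_comp f.w_left g.w_left (f ≫ g).w_left rfl h)
    (baseChange_comp f.w g.w (f ≫ g).w rfl h)))

lemma pullbackSlice_isLift (u : I ⥤ Arrow E) {X Y : E} (h : X ⟶ Y) :
    IsLift (Slice.toOver (RightMap.forget u) Y) (Slice.toOver (RightMap.forget u) X)
      (Over.pullback h).mapArrow (pullbackSlice u h) :=
  rfl

variable (E) in
/-- Every pullback functor `Over Y ⥤ Over X` has a right adjoint. -/
class HasPushforwards : Prop where
  isLeftAdjoint {X Y : E} (f : X ⟶ Y) : (Over.pullback f).IsLeftAdjoint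

attribute [instance] HasPushforwards.isLeftAdjoint

variable [HasPushforwards E]

/-- Pushforward along `f`, the right adjoint of pullback along `f`. -/
noncomputable def pushforward {X Y : E} (f : X ⟶ Y) : Over X ⥤ Over Y :=
  (Over.pullback f).rightAdjoint

/-- The adjunction `f^* ⊣ f_*`. -/
noncomputable def pullbackPushforwardAdj {X Y : E} (f : X ⟶ Y) : Over.pullback f ⊣ pushforward f :=
  Adjunction.ofIsLeftAdjoint _

/-- For a square `τ = (s, t)` from `g : C ⟶ D` to `h : C' ⟶ D'`, the canonical natural
transformation `φ : s_! g^* ⟶ h^* t_!`. -/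
noncomputable def beckChevalleyLeft {g h : Arrow E} (τ : g ⟶ h) :
    Over.pullback g.hom ⋙ Over.map τ.left ⟶ Over.map τ.right ⋙ Over.pullback h.hom where
  app Z := Over.homMk
    (pullback.map Z.hom g.hom (Z.hom ≫ τ.right) h.hom (𝟙 _) τ.left τ.right
      (Category.id_comp _).symm (Arrow.w τ).symm)
    (pullback.lift_snd _ _ _)
  naturality Z W f := Over.OverMorphism.ext (by
    refine pullback.hom_ext (f := W.hom ≫ τ.right) (g := h.hom) ?_ ?_
    · refine (Category.assoc _ _ _).trans ((congrArg (_ ≫ ·) (pullback.lift_fst _ _ _)).trans ?_)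
      refine Eq.trans ?_ (Category.assoc _ _ _).symm
      refine Eq.trans ?_ (congrArg (_ ≫ ·) (pullback.lift_fst _ _ _).symm)
      refine (pullback.lift_fst_assoc _ _ _ _).trans
        (Eq.trans ?_ (pullback.lift_fst_assoc _ _ _ _).symm)
      exact (Category.comp_id _).trans (congrArg (· ≫ f.left) (Category.comp_id _).symm)
    · refine (Category.assoc _ _ _).trans ((congrArg (_ ≫ ·) (pullback.lift_snd _ _ _)).trans ?_)
      refine Eq.trans ?_ (Category.assoc _ _ _).symm
      refine Eq.trans ?_ (congrArg (_ ≫ ·) (pullback.lift_snd _ _ _).symm)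
      exact (pullback.lift_snd_assoc _ _ _ _).trans (pullback.lift_snd _ _ _).symm)

/-- For a square `τ = (s, t)` from `g : C ⟶ D` to `h : C' ⟶ D'`, the canonical natural
transformation `ψ : t^* h_* ⟶ g_* s^*`, the mate of `φ` under the adjunctions
`s_! g^* ⊣ g_* s^*` and `h^* t_! ⊣ t^* h_*`. -/
noncomputable def beckChevalley {g h : Arrow E} (τ : g ⟶ h) :
    pushforward h.hom ⋙ Over.pullback τ.right ⟶ Over.pullback τ.left ⋙ pushforward g.hom :=
  conjugateEquiv ((Over.mapPullbackAdj τ.right).comp (pullbackPushforwardAdj h.hom))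
    ((pullbackPushforwardAdj g.hom).comp (Over.mapPullbackAdj τ.left)) (beckChevalleyLeft τ)

/-- The pushforward condition for `u : I ⥤ E^→`, `v : J ⥤ E^→`, `w : K ⥤ E^→`:
for every `j` in `J`, pushforward along `v j : C_j ⟶ D_j` lifts to a functor
`(K^⋔)_{/C_j} ⥤ (I^⋔)_{/D_j}`, and for every `τ : j ⟶ k` in `J` with `v τ = (s, t)`, the canonical
transformation `ψ : t^* (v k)_* ⟶ (v j)_* s^*` lifts to a natural transformation between the lifted
functors. -/
def PushforwardFrobenius {J : Type u₂} [Category.{v₂} J] {K : Type u₃} [Category.{v₃} K]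
    (u : I ⥤ Arrow E) (v : J ⥤ Arrow E) (w : K ⥤ Arrow E) : Prop :=
  ∃ (V : ∀ j : J, Slice (RightMap.forget w) (v.obj j).left ⥤
        Slice (RightMap.forget u) (v.obj j).right)
    (hV : ∀ j : J, IsLift (Slice.toOver (RightMap.forget w) (v.obj j).left)
      (Slice.toOver (RightMap.forget u) (v.obj j).right)
      (pushforward (v.obj j).hom).mapArrow (V j)),
    ∀ {j k : J} (τ : j ⟶ k),
      LiftsNatTrans
        (F := (pushforward (v.obj k).hom ⋙ Over.pullback (v.map τ).right).mapArrow)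
        (G := (Over.pullback (v.map τ).left ⋙ pushforward (v.obj j).hom).mapArrow)
        ((hV k).comp_mapArrow (pullbackSlice_isLift u (v.map τ).right))
        ((pullbackSlice_isLift w (v.map τ).left).comp_mapArrow (hV j))
        ((Functor.mapArrowFunctor _ _).map (beckChevalley (v.map τ)))

end Pushforward

end AlgFrobenius

open AlgFrobenius

/-! All five conditions are expressed by one kind of datum, `Lifting G r`: fillers of a family `G`
of arrows against a family `r`, natural in both. By currying, this is a functor into left `r`-maps
or a functor into right `G`-maps, over the arrow category (`Lifting.toLeftMap`,
`Lifting.toRightMap`). The relevant left family is `totalPullback u v`, consisting of the pullbacks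
of the arrows `u i` along the arrows `v j` into their base.

Generalized Frobenius. The base and the legs of `Q` leave nothing to choose, so a lift of `Q` is a
structure on the pulled-back arrows only. For left maps or coalgebras, such a structure amounts to
fillers for `totalPullback u v` (`generalizedFrobenius_leftMap_iff`,
`AWFS.generalizedFrobenius_iff`).

Pushforward. Fillers of `u i` against a pushforward along `v j` transpose to fillers of the pullback
of `u i` along `v j`. Since ψ is the mate of φ, compatibility with ψ becomes compatibility of the
transposed fillers along maps of `J`. These fillers only treat right maps over the domain of `v j`.
An arbitrary square to a right map `g` is brought there by pulling `g` back to the codomain of the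
source arrow (`Slice.graph`). The outcome is `pushforwardFrobenius_iff`: the condition says that
`totalPullback u v` lifts against right `w`-maps.

Coalgebras. Coalgebras lift against algebras by the factorization. Conversely, fillers against monad
algebras include a filler for the unit square from `f` to the free algebra `R f`, which is a
coalgebra structure on `f` (`AWFS.coalgOfLifting`); the dual argument yields algebras. An algebra
for the pointed endofunctor is a retract of a free one, so the two kinds of algebra can be
exchanged.

Conditions 2 to 5 thus concern the same fillers, up to the exchange of monad algebras with right
`u`-maps that freeness provides. Condition 1 differs in ranging over all coalgebras and not only
over the generators `u`. To go down to generators, the algebra is pulled back to the codomain of `u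
i` and the iterated pullback is identified (`AWFS.FunctorialFrobenius.lifting`). To go up,
pushforwards are essential: the pushforward condition sees `u` only through right `u`-maps
(`PushforwardFrobenius.of_lifting`), and coalgebras lift against these, so `u` may be replaced by
the family of all coalgebras. -/

namespace AlgFrobenius

/-! ### Lifting structures -/

section Lifting

variable {C : Type u} [Category.{v} C] {X : Type u₁} [Category.{v₁} X] {Y : Type u₂} [Category.{v₂} Y]

/-- A lifting structure of `G : X ⥤ C^→` against `r : Y ⥤ C^→`: a choice of diagonal filler for every
commutative square from some `G x` to some `r y`, natural in `x` and `y`. -/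
structure Lifting (G : X ⥤ Arrow C) (r : Y ⥤ Arrow C) where
  fill (x : X) (y : Y) (sq : G.obj x ⟶ r.obj y) : (G.obj x).right ⟶ (r.obj y).left
  hom_fill (x : X) (y : Y) (sq : G.obj x ⟶ r.obj y) : (G.obj x).hom ≫ fill x y sq = sq.left
  fill_hom (x : X) (y : Y) (sq : G.obj x ⟶ r.obj y) : fill x y sq ≫ (r.obj y).hom = sq.right
  natural {x x' : X} (f : x ⟶ x') {y y' : Y} (g : y ⟶ y') (sq : G.obj x ⟶ r.obj y)
    (sq' : G.obj x' ⟶ r.obj y') (h : sq ≫ r.map g = G.map f ≫ sq') :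
    fill x y sq ≫ (r.map g).left = (G.map f).right ≫ fill x' y' sq'

namespace Lifting

variable {G : X ⥤ Arrow C} {r : Y ⥤ Arrow C}

lemma natural_left (Λ : Lifting G r) {x x' : X} (f : x ⟶ x') {y : Y} (sq : G.obj x' ⟶ r.obj y) :
    Λ.fill x y (G.map f ≫ sq) = (G.map f).right ≫ Λ.fill x' y sq := by
  have h := Λ.natural f (𝟙 y) (G.map f ≫ sq) sq (by rw [r.map_id, Category.comp_id])
  rwa [r.map_id, Arrow.id_left, Category.comp_id] at h

lemma natural_right (Λ : Lifting G r) {x : X} {y y' : Y} (g : y ⟶ y') (sq : G.obj x ⟶ r.obj y) :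
    Λ.fill x y sq ≫ (r.map g).left = Λ.fill x y' (sq ≫ r.map g) := by
  have h := Λ.natural (𝟙 x) g sq (sq ≫ r.map g) (by rw [G.map_id, Category.id_comp])
  rwa [G.map_id, Arrow.id_right, Category.id_comp] at h

/-- Restriction of a lifting structure along functors into the two indexing categories. -/
def precomp (Λ : Lifting G r) {X' : Type u₃} [Category.{v₃} X'] {Y' : Type u₄} [Category.{v₄} Y']
    (a : X' ⥤ X) (b : Y' ⥤ Y) : Lifting (a ⋙ G) (b ⋙ r) where
  fill x y sq := Λ.fill (a.obj x) (b.obj y) sq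
  hom_fill _ _ _ := Λ.hom_fill _ _ _
  fill_hom _ _ _ := Λ.fill_hom _ _ _
  natural f _ _ g sq sq' h := Λ.natural (a.map f) (b.map g) sq sq' h

/-- Lifting structures pass to retracts of the right family. -/
def retractRight (Λ : Lifting G r) {r' : Y ⥤ Arrow C} (ι : r' ⟶ r) (ρ : r ⟶ r') (h : ι ≫ ρ = 𝟙 r') :
    Lifting G r' where
  fill x y sq := Λ.fill x y (sq ≫ ι.app y) ≫ (ρ.app y).left
  hom_fill x y sq := by
    have e : (ι.app y ≫ ρ.app y).left = 𝟙 _ := by rw [← NatTrans.comp_app, h]; rfl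
    rw [← Category.assoc, Λ.hom_fill, Arrow.comp_left, Category.assoc, ← Arrow.comp_left, e,
      Category.comp_id]
  fill_hom x y sq := by
    have e : (ι.app y ≫ ρ.app y).right = 𝟙 _ := by rw [← NatTrans.comp_app, h]; rfl
    rw [Category.assoc, Arrow.w, ← Category.assoc, Λ.fill_hom, Arrow.comp_right, Category.assoc,
      ← Arrow.comp_right, e, Category.comp_id]
  natural {x x'} f y y' g sq sq' h := by
    rw [Category.assoc, ← Arrow.comp_left, ← ρ.naturality, Arrow.comp_left, ← Category.assoc,
      Λ.natural f g _ (sq' ≫ ι.app y'), Category.assoc]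
    rw [Category.assoc, ← ι.naturality, ← Category.assoc, h, Category.assoc]

/-- Lifting structures pass to retracts of the left family. -/
def retractLeft (Λ : Lifting G r) {G' : X ⥤ Arrow C} (ι : G' ⟶ G) (ρ : G ⟶ G') (h : ι ≫ ρ = 𝟙 G') :
    Lifting G' r where
  fill x y sq := (ι.app x).right ≫ Λ.fill x y (ρ.app x ≫ sq)
  hom_fill x y sq := by
    have e : (ι.app x ≫ ρ.app x).left = 𝟙 _ := by rw [← NatTrans.comp_app, h]; rfl
    rw [← Arrow.w_assoc, Λ.hom_fill, Arrow.comp_left, ← Category.assoc, ← Arrow.comp_left, e,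
      Category.id_comp]
  fill_hom x y sq := by
    have e : (ι.app x ≫ ρ.app x).right = 𝟙 _ := by rw [← NatTrans.comp_app, h]; rfl
    rw [Category.assoc, Λ.fill_hom, Arrow.comp_right, ← Category.assoc, ← Arrow.comp_right, e,
      Category.id_comp]
  natural {x x'} f y y' g sq sq' h := by
    rw [Category.assoc, Λ.natural f g _ (ρ.app x' ≫ sq'), ← Category.assoc, ← Arrow.comp_right,
      ← ι.naturality, Arrow.comp_right, Category.assoc]
    rw [Category.assoc, h, ← Category.assoc, ← ρ.naturality, Category.assoc]

end Lifting

/-! ### Transposition of squares and fillers along an adjunction -/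

/-- The transpose of a square under the arrow-wise extension of an adjunction. -/
def transposeSq {D : Type u₃} [Category.{v₃} D] {L : D ⥤ C} {R : C ⥤ D} (adj : L ⊣ R) {f : Arrow D}
    {g : Arrow C} (sq : L.mapArrow.obj f ⟶ g) : f ⟶ R.mapArrow.obj g :=
  Arrow.homMk (adj.homEquiv _ _ sq.left) (adj.homEquiv _ _ sq.right) (by
    have h : sq.left ≫ g.hom = L.map f.hom ≫ sq.right := Arrow.w sq
    exact (adj.homEquiv_naturality_right _ _).symm.trans
      ((congrArg _ h).trans (adj.homEquiv_naturality_left _ _)))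

/-- The inverse of `transposeSq`. -/
def untransposeSq {D : Type u₃} [Category.{v₃} D] {L : D ⥤ C} {R : C ⥤ D} (adj : L ⊣ R) {f : Arrow D}
    {g : Arrow C} (sq : f ⟶ R.mapArrow.obj g) : L.mapArrow.obj f ⟶ g :=
  Arrow.homMk ((adj.homEquiv _ _).symm sq.left) ((adj.homEquiv _ _).symm sq.right) (by
    have h : sq.left ≫ R.map g.hom = f.hom ≫ sq.right := Arrow.w sq
    exact (adj.homEquiv_naturality_right_symm _ _).symm.trans
      ((congrArg _ h).trans (adj.homEquiv_naturality_left_symm _ _)))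

section Transpose

variable {D : Type u₃} [Category.{v₃} D] {L : D ⥤ C} {R : C ⥤ D} (adj : L ⊣ R)

lemma untransposeSq_transposeSq {f : Arrow D} {g : Arrow C} (sq : L.mapArrow.obj f ⟶ g) :
    untransposeSq adj (transposeSq adj sq) = sq :=
  Arrow.hom_ext _ _ ((adj.homEquiv _ _).symm_apply_apply _) ((adj.homEquiv _ _).symm_apply_apply _)

lemma transposeSq_untransposeSq {f : Arrow D} {g : Arrow C} (sq : f ⟶ R.mapArrow.obj g) :
    transposeSq adj (untransposeSq adj sq) = sq :=
  Arrow.hom_ext _ _ ((adj.homEquiv _ _).apply_symm_apply _) ((adj.homEquiv _ _).apply_symm_apply _)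

lemma transposeSq_comp {f : Arrow D} {g g' : Arrow C} (sq : L.mapArrow.obj f ⟶ g) (k : g ⟶ g') :
    transposeSq adj (sq ≫ k) = transposeSq adj sq ≫ R.mapArrow.map k :=
  Arrow.hom_ext _ _ (adj.homEquiv_naturality_right _ _) (adj.homEquiv_naturality_right _ _)

lemma transposeSq_map_comp {f f' : Arrow D} {g : Arrow C} (k : f' ⟶ f) (sq : L.mapArrow.obj f ⟶ g) :
    transposeSq adj (L.mapArrow.map k ≫ sq) = k ≫ transposeSq adj sq :=
  Arrow.hom_ext _ _ (adj.homEquiv_naturality_left _ _) (adj.homEquiv_naturality_left _ _)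

lemma untransposeSq_comp {f : Arrow D} {g g' : Arrow C} (sq : f ⟶ R.mapArrow.obj g) (k : g ⟶ g') :
    untransposeSq adj (sq ≫ R.mapArrow.map k) = untransposeSq adj sq ≫ k :=
  Arrow.hom_ext _ _ (adj.homEquiv_naturality_right_symm _ _)
    (adj.homEquiv_naturality_right_symm _ _)

lemma untransposeSq_map_comp {f f' : Arrow D} {g : Arrow C} (k : f' ⟶ f)
    (sq : f ⟶ R.mapArrow.obj g) :
    untransposeSq adj (k ≫ sq) = L.mapArrow.map k ≫ untransposeSq adj sq :=
  Arrow.hom_ext _ _ (adj.homEquiv_naturality_left_symm _ _)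
    (adj.homEquiv_naturality_left_symm _ _)

namespace Lifting

variable {G : X ⥤ Arrow D} {r : Y ⥤ Arrow C}

/-- Transposition of lifting structures along an adjunction, from left to right. -/
def transpose (Λ : Lifting (G ⋙ L.mapArrow) r) : Lifting G (r ⋙ R.mapArrow) where
  fill x y sq := adj.homEquiv _ _ (Λ.fill x y (untransposeSq adj sq))
  hom_fill x y sq := (adj.homEquiv_naturality_left _ _).symm.trans
    ((congrArg _ (Λ.hom_fill x y _)).trans ((adj.homEquiv _ _).apply_symm_apply _))
  fill_hom x y sq := (adj.homEquiv_naturality_right _ _).symm.trans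
    ((congrArg _ (Λ.fill_hom x y _)).trans ((adj.homEquiv _ _).apply_symm_apply _))
  natural f _ _ g sq sq' h := (adj.homEquiv_naturality_right _ _).symm.trans
    ((congrArg _ (Λ.natural f g _ _ (by
      refine (untransposeSq_comp adj _ _).symm.trans ((congrArg _ h).trans ?_)
      exact untransposeSq_map_comp adj _ _))).trans (adj.homEquiv_naturality_left _ _))

/-- Transposition of lifting structures along an adjunction, from right to left. -/
def untranspose (Λ : Lifting G (r ⋙ R.mapArrow)) : Lifting (G ⋙ L.mapArrow) r where
  fill x y sq := (adj.homEquiv _ _).symm (Λ.fill x y (transposeSq adj sq))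
  hom_fill x y sq := (adj.homEquiv_naturality_left_symm _ _).symm.trans
    ((congrArg _ (Λ.hom_fill x y _)).trans ((adj.homEquiv _ _).symm_apply_apply _))
  fill_hom x y sq := (adj.homEquiv_naturality_right_symm _ _).symm.trans
    ((congrArg _ (Λ.fill_hom x y _)).trans ((adj.homEquiv _ _).symm_apply_apply _))
  natural f _ _ g sq sq' h := (adj.homEquiv_naturality_right_symm _ _).symm.trans
    ((congrArg _ (Λ.natural f g _ _ (by
      refine (transposeSq_comp adj _ _).symm.trans ((congrArg _ h).trans ?_)
      exact transposeSq_map_comp adj _ _))).trans (adj.homEquiv_naturality_left_symm _ _))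

end Lifting

end Transpose

end Lifting

/-! ### Lifting structures as functors into left and right maps -/

section LeftMaps

variable {E : Type u} [Category.{v} E] {X : Type u₁} [Category.{v₁} X] {Y : Type u₂}
  [Category.{v₂} Y]

/-- The tautological lifting structure of left maps. -/
def LeftMap.lifting (r : Y ⥤ Arrow E) : Lifting (LeftMap.forget r) r where
  fill x y sq := x.fill y sq
  hom_fill x y sq := x.hom_fill y sq
  fill_hom x y sq := x.fill_hom y sq
  natural {x _} f _ y' g sq sq' h :=
    (x.natural g sq).trans ((congrArg (x.fill y') h).trans (f.comp_fill y' sq').symm)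

/-- The tautological lifting structure of right maps. -/
def RightMap.lifting (G : X ⥤ Arrow E) : Lifting G (RightMap.forget G) where
  fill x y sq := y.fill x sq
  hom_fill x y sq := y.hom_fill x sq
  fill_hom x y sq := y.fill_hom x sq
  natural {x _} f _ y' g sq sq' h :=
    (g.fill_comp x sq).trans ((congrArg (y'.fill x) h).trans (y'.natural f sq').symm)

/-- The functor to left maps given by a lifting structure. -/
def Lifting.toLeftMap {G : X ⥤ Arrow E} {r : Y ⥤ Arrow E} (Λ : Lifting G r) : X ⥤ LeftMap r where
  obj x :=
    { arrow := G.obj x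
      fill := Λ.fill x
      hom_fill := Λ.hom_fill x
      fill_hom := Λ.fill_hom x
      natural := fun σ sq => Λ.natural_right σ sq }
  map f :=
    { sq := G.map f
      comp_fill := fun _ s => (Λ.natural_left f s).symm }
  map_id x := LeftMap.Hom.ext (G.map_id x)
  map_comp f g := LeftMap.Hom.ext (G.map_comp f g)

/-- The functor to right maps given by a lifting structure. -/
def Lifting.toRightMap {G : X ⥤ Arrow E} {r : Y ⥤ Arrow E} (Λ : Lifting G r) :
    Y ⥤ RightMap G where
  obj y :=
    { arrow := r.obj y
      fill := fun x => Λ.fill x y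
      hom_fill := fun x => Λ.hom_fill x y
      fill_hom := fun x => Λ.fill_hom x y
      natural := fun σ sq => (Λ.natural_left σ sq).symm }
  map g :=
    { sq := r.map g
      fill_comp := fun _ s => Λ.natural_right g s }
  map_id y := RightMap.Hom.ext (r.map_id y)
  map_comp f g := RightMap.Hom.ext (r.map_comp f g)

end LeftMaps

/-! ### Generalized Frobenius conditions as lifting structures -/

section TotalPullback

variable {E : Type u} [Category.{v} E] {I : Type u₁} [Category.{v₁} I] {J : Type u₂}
  [Category.{v₂} J] {K : Type u₃} [Category.{v₃} K]

/-- The arrow underlying an object of `K_{/E}`. -/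
def Triangle.arrow {B : Type u₂} [Category.{v₂} B] (w : K ⥤ Arrow E) (s : B ⥤ E) :
    Triangle w s ⥤ Arrow E where
  obj x := w.obj x.i
  map f := w.map f.i
  map_id _ := w.map_id _
  map_comp _ _ := w.map_comp _ _

/-- The projection of `K_{/E}` to `K`. -/
def Triangle.index {B : Type u₂} [Category.{v₂} B] (w : K ⥤ Arrow E) (s : B ⥤ E) :
    Triangle w s ⥤ K where
  obj x := x.i
  map f := f.i

variable [HasPullbacks E]

/-- The functor sending an arrow `u i` over the codomain of `v j` to its pullback along `v j`. -/
noncomputable def totalPullback (u : I ⥤ Arrow E) (v : J ⥤ Arrow E) :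
    Triangle u (v ⋙ Arrow.rightFunc) ⥤ Arrow E :=
  Triangle.prod u v ⋙ pullbackQ ⋙ Triangle.arrow (𝟭 (Arrow E)) (𝟭 E)

/-- A lift of `Q` names, functorially, an object of `K` whose arrow is the given pullback; the
fillers of `w` are restricted along it. Because lifts are strict, the equality of functors can be
rewritten. -/
lemma GeneralizedFrobenius.lifting {Y : Type u₄} [Category.{v₄} Y] {u : I ⥤ Arrow E}
    {v : J ⥤ Arrow E} {w : K ⥤ Arrow E} (h : GeneralizedFrobenius u v w) {r : Y ⥤ Arrow E}
    (Λ : Lifting w r) : Nonempty (Lifting (totalPullback u v) r) := by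
  obtain ⟨H, hH⟩ := h
  have e : (H ⋙ Triangle.index w (𝟭 E)) ⋙ w = totalPullback u v :=
    congrArg (fun F => F ⋙ Triangle.arrow (𝟭 (Arrow E)) (𝟭 E)) hH
  rw [← e]
  exact ⟨Λ.precomp _ (𝟭 _)⟩

/-- Assembling a functor to `E^→_{/E}` from its components. -/
def Triangle.functorMk {X : Type u₄} [Category.{v₄} X] (G : X ⥤ Arrow E) (B : X ⥤ E)
    (a : ∀ x, (G.obj x).left ⟶ B.obj x) (b : ∀ x, (G.obj x).right ⟶ B.obj x)
    (h : ∀ x, (G.obj x).hom ≫ b x = a x)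
    (hb : ∀ {x y : X} (f : x ⟶ y), (G.map f).right ≫ b y = b x ≫ B.map f) :
    X ⥤ Triangle (𝟭 (Arrow E)) (𝟭 E) where
  obj x := ⟨B.obj x, G.obj x, a x, b x, h x⟩
  map f := ⟨B.map f, G.map f, hb f⟩
  map_id x := Triangle.Hom.ext (B.map_id x) (G.map_id x)
  map_comp f g := Triangle.Hom.ext (B.map_comp f g) (G.map_comp f g)

/-- The base and the two legs can be copied verbatim, since they depend on the underlying arrow
alone. Keeping `G` a variable allows `hF` to be eliminated, so that no transport of legs along an
equality of arrows appears. -/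
lemma Triangle.exists_lift {X : Type u₄} [Category.{v₄} X] {w : K ⥤ Arrow E} (F : X ⥤ K)
    {G : X ⥤ Arrow E} (hF : F ⋙ w = G) (B : X ⥤ E)
    (a : ∀ x, (G.obj x).left ⟶ B.obj x) (b : ∀ x, (G.obj x).right ⟶ B.obj x)
    (h : ∀ x, (G.obj x).hom ≫ b x = a x)
    (hb : ∀ {x y : X} (f : x ⟶ y), (G.map f).right ≫ b y = b x ≫ B.map f) :
    ∃ H : X ⥤ Triangle w (𝟭 E), H ⋙ Triangle.total w = Triangle.functorMk G B a b h hb := by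
  subst hF
  exact ⟨{ obj := fun x => ⟨B.obj x, F.obj x, a x, b x, h x⟩
           map := fun f => ⟨B.map f, F.map f, hb f⟩
           map_id := fun x => Triangle.Hom.ext (B.map_id x) (F.map_id x)
           map_comp := fun f g => Triangle.Hom.ext (B.map_comp f g) (F.map_comp f g) }, rfl⟩

/-- The projection of `B ×_E K_{/E}` to `B`. -/
def Triangle.baseFunctor {B : Type u₂} [Category.{v₂} B] (w : K ⥤ Arrow E) (s : B ⥤ E) :
    Triangle w s ⥤ B where
  obj x := x.base
  map f := f.base

lemma GeneralizedFrobenius.of_lift {u : I ⥤ Arrow E} {v : J ⥤ Arrow E} {w : K ⥤ Arrow E}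
    (F : Triangle u (v ⋙ Arrow.rightFunc) ⥤ K) (hF : F ⋙ w = totalPullback u v) :
    GeneralizedFrobenius u v w :=
  let Q := Triangle.prod u v ⋙ pullbackQ (E := E)
  Triangle.exists_lift F hF (Q ⋙ Triangle.baseFunctor _ _) (fun x => (Q.obj x).a)
    (fun x => (Q.obj x).b) (fun x => (Q.obj x).w) (fun f => (Q.map f).w)

/-- Left `r`-maps are the universal family lifting against `r`. -/
lemma generalizedFrobenius_leftMap_iff {Y : Type u₄} [Category.{v₄} Y] {u : I ⥤ Arrow E}
    {v : J ⥤ Arrow E} {r : Y ⥤ Arrow E} :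
    GeneralizedFrobenius u v (LeftMap.forget r) ↔ Nonempty (Lifting (totalPullback u v) r) :=
  ⟨fun h => h.lifting (LeftMap.lifting r), fun ⟨Λ⟩ => .of_lift Λ.toLeftMap rfl⟩

end TotalPullback

/-! ### Lifting structures over slices -/

section SliceLifting

variable {E : Type u} [Category.{v} E] {I : Type u₁} [Category.{v₁} I] {Y : Type u₂}
  [Category.{v₂} Y] {K : Type u₃} [Category.{v₃} K]

/-- The functor `I_{/X} ⥤ I_{/Z}` given by composition with `t : X ⟶ Z`. -/
def Slice.map (u : I ⥤ Arrow E) {X Z : E} (t : X ⟶ Z) : Slice u X ⥤ Slice u Z where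
  obj x := ⟨x.i, x.a ≫ t, x.b ≫ t, by rw [← Category.assoc, x.w]⟩
  map f := ⟨f.i, (Category.assoc _ _ _).symm.trans (congrArg (· ≫ t) f.w)⟩

/-- The square in `E` underlying a square in `E_{/X}`. -/
def overSq {X : E} {f g : Arrow (Over X)} (sq : f ⟶ g) :
    Arrow.mk f.hom.left ⟶ Arrow.mk g.hom.left :=
  Arrow.homMk sq.left.left sq.right.left (congrArg CommaMorphism.left (Arrow.w sq))

/-- Right maps over `X` have fillers in `E_{/X}`. -/
def Slice.lifting (u : I ⥤ Arrow E) (X : E) :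
    Lifting (Slice.toOver u X) (Slice.toOver (RightMap.forget u) X) where
  fill x y sq := Over.homMk (y.i.fill x.i (overSq sq)) (by
    have h : y.i.fill x.i (overSq sq) ≫ y.i.arrow.hom = sq.right.left := y.i.fill_hom x.i _
    refine (congrArg (_ ≫ ·) y.w.symm).trans ?_
    refine (Category.assoc _ _ _).symm.trans ((congrArg (· ≫ y.b) h).trans ?_)
    exact Over.w sq.right)
  hom_fill x y sq := Over.OverMorphism.ext (y.i.hom_fill x.i _)
  fill_hom x y sq := Over.OverMorphism.ext (y.i.fill_hom x.i _)
  natural f _ _ g sq sq' h := Over.OverMorphism.ext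
    ((RightMap.lifting u).natural f.i g.i (overSq sq) (overSq sq') (congrArg overSq h))

variable {u : I ⥤ Arrow E} {X : E} {r : Y ⥤ Arrow (Over X)}

/-- The object of `I_{/X}` given by a square from `u i` to the underlying arrow of an arrow of
`E_{/X}`. -/
def Slice.ofSq {i : I} {g : Arrow (Over X)} (sq : u.obj i ⟶ Arrow.mk g.hom.left) : Slice u X where
  i := i
  a := sq.left ≫ g.left.hom
  b := sq.right ≫ g.right.hom
  w := by
    rw [← Category.assoc, ← Arrow.w sq, Category.assoc]
    exact congrArg (_ ≫ ·) (Over.w g.hom)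

/-- A square from `u i` to the underlying arrow of an arrow of `E_{/X}`, as a square over `X`. -/
def Slice.ofSqHom {i : I} {g : Arrow (Over X)} (sq : u.obj i ⟶ Arrow.mk g.hom.left) :
    (Slice.toOver u X).obj (Slice.ofSq sq) ⟶ g :=
  Arrow.homMk (Over.homMk sq.left rfl) (Over.homMk sq.right rfl)
    (Over.OverMorphism.ext (Arrow.w sq))

/-- A square over `X` determines the structure maps of its source: `b` is the composite through the
codomain of `r y`, and `a` follows from the triangle. This permits comparing fillers at slice
objects that are equal only propositionally. -/
lemma Lifting.fill_left_congr (Λ : Lifting (Slice.toOver u X) r) {i : I}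
    {a a' : (u.obj i).left ⟶ X} {b b' : (u.obj i).right ⟶ X} {w : (u.obj i).hom ≫ b = a}
    {w' : (u.obj i).hom ≫ b' = a'} {y : Y} (sq : (Slice.toOver u X).obj ⟨i, a, b, w⟩ ⟶ r.obj y)
    (sq' : (Slice.toOver u X).obj ⟨i, a', b', w'⟩ ⟶ r.obj y) (h : overSq sq = overSq sq') :
    (Λ.fill _ y sq).left = (Λ.fill _ y sq').left := by
  have hb : b = b' := (Over.w sq.right).symm.trans
    ((congrArg (fun z => Arrow.Hom.right z ≫ (r.obj y).right.hom) h).trans (Over.w sq'.right))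
  subst hb w w'
  have : sq = sq' := Arrow.hom_ext _ _
    (Over.OverMorphism.ext (congrArg (fun z => Arrow.Hom.left z) h))
    (Over.OverMorphism.ext (congrArg (fun z => Arrow.Hom.right z) h))
  rw [this]

lemma Lifting.fill_ofSqHom_comp (Λ : Lifting (Slice.toOver u X) r) {y y' : Y} (g : y ⟶ y') {i : I}
    (s : u.obj i ⟶ Arrow.mk (r.obj y).hom.left) :
    (Λ.fill _ y (Slice.ofSqHom s)).left ≫ (r.map g).left.left =
      (Λ.fill _ y' (Slice.ofSqHom (g := r.obj y') (s ≫ overSq (r.map g)))).left :=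
  (congrArg CommaMorphism.left (Λ.natural_right g (Slice.ofSqHom s))).trans
    (Λ.fill_left_congr _ _ (Arrow.hom_ext _ _ rfl rfl))

/-- The functor to `(I^⋔)_{/X}` given by a lifting structure in `E_{/X}`. -/
def Lifting.toSlice (Λ : Lifting (Slice.toOver u X) r) : Y ⥤ Slice (RightMap.forget u) X where
  obj y :=
    { i :=
        { arrow := Arrow.mk (r.obj y).hom.left
          fill i sq := (Λ.fill (Slice.ofSq sq) y (Slice.ofSqHom sq)).left
          hom_fill i sq := congrArg CommaMorphism.left (Λ.hom_fill (Slice.ofSq sq) y _)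
          fill_hom i sq := congrArg CommaMorphism.left (Λ.fill_hom (Slice.ofSq sq) y _)
          natural {i j} σ sq := by
            let f : Slice.ofSq (u.map σ ≫ sq) ⟶ Slice.ofSq sq := ⟨σ, (Category.assoc _ _ _).symm⟩
            exact (congrArg CommaMorphism.left
              (Λ.natural_left f (Slice.ofSqHom sq))).symm.trans
              (Λ.fill_left_congr _ _ rfl) }
      a := (r.obj y).left.hom
      b := (r.obj y).right.hom
      w := Over.w (r.obj y).hom }
  map {y y'} g :=
    { i :=
        { sq := overSq (r.map g)
          fill_comp i s := Λ.fill_ofSqHom_comp g s }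
      w := Over.w (r.map g).right }
  map_id y := Slice.Hom.ext (RightMap.Hom.ext (congrArg overSq (r.map_id y)))
  map_comp f g := Slice.Hom.ext (RightMap.Hom.ext (congrArg overSq (r.map_comp f g)))

end SliceLifting

/-! ### The pushforward condition as a lifting structure -/

section PushforwardLifting

/-! ### Mates and the two forms of coherence -/

/-- Writing both transposes through the units reduces the claim to the compatibility of conjugates
with units and to naturality. -/
lemma conjugateEquiv_homEquiv {C : Type u₁} [Category.{v₁} C] {D : Type u₂} [Category.{v₂} D]
    {L₁ L₂ : C ⥤ D} {R₁ R₂ : D ⥤ C} (adj₁ : L₁ ⊣ R₁) (adj₂ : L₂ ⊣ R₂) (α : L₂ ⟶ L₁) {c : C} {d : D}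
    (f : L₁.obj c ⟶ d) :
    adj₂.homEquiv _ _ (α.app c ≫ f) =
      adj₁.homEquiv _ _ f ≫ (conjugateEquiv adj₁ adj₂ α).app d := by
  rw [Adjunction.homEquiv_unit, Adjunction.homEquiv_unit, Functor.map_comp, ← Category.assoc,
    ← unit_conjugateEquiv, Category.assoc, Category.assoc, NatTrans.naturality]

variable {E : Type u} [Category.{v} E] [HasPullbacks E] [HasPushforwards E]
  {I : Type u₁} [Category.{v₁} I] {J : Type u₂} [Category.{v₂} J] {K : Type u₃} [Category.{v₃} K]

/-- The form in which the mate property of ψ is used: transposing a composite with φ gives a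
composite with ψ. The two composite adjunctions are split into single transpositions. -/
lemma beckChevalley_homEquiv {g h : Arrow E} (τ : g ⟶ h) {Z : Over g.right} {W : Over h.left}
    (f : (Over.pullback h.hom).obj ((Over.map τ.right).obj Z) ⟶ W) :
    (pullbackPushforwardAdj g.hom).homEquiv _ _ ((Over.mapPullbackAdj τ.left).homEquiv _ _
        ((beckChevalleyLeft τ).app Z ≫ f)) =
      (Over.mapPullbackAdj τ.right).homEquiv _ _ ((pullbackPushforwardAdj h.hom).homEquiv _ _ f) ≫
        (beckChevalley τ).app W := by
  have h := conjugateEquiv_homEquiv ((Over.mapPullbackAdj τ.right).comp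
    (pullbackPushforwardAdj h.hom)) ((pullbackPushforwardAdj g.hom).comp
      (Over.mapPullbackAdj τ.left)) (beckChevalleyLeft τ) f
  rw [Adjunction.comp_homEquiv, Adjunction.comp_homEquiv] at h
  exact h

section Squares

variable {g h : Arrow E} (τ : g ⟶ h) (z : Arrow (Over g.right)) (y : Arrow (Over h.left))

/-- The action of the canonical transformation `ψ : t^* h_* ⟶ g_* s^*` on arrows. -/
noncomputable def beckChevalleySq :
    (Over.pullback τ.right).mapArrow.obj ((pushforward h.hom).mapArrow.obj y) ⟶
      (pushforward g.hom).mapArrow.obj ((Over.pullback τ.left).mapArrow.obj y) :=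
  ((Functor.mapArrowFunctor _ _).map (beckChevalley τ)).app y

/-- The action of the canonical transformation `φ : s_! g^* ⟶ h^* t_!` on arrows. -/
noncomputable def beckChevalleyLeftSq :
    (Over.map τ.left).mapArrow.obj ((Over.pullback g.hom).mapArrow.obj z) ⟶
      (Over.pullback h.hom).mapArrow.obj ((Over.map τ.right).mapArrow.obj z) :=
  ((Functor.mapArrowFunctor _ _).map (beckChevalleyLeft τ)).app z

variable {z y} in
lemma beckChevalleySq_transposeSq
    (sq : (Over.pullback h.hom).mapArrow.obj ((Over.map τ.right).mapArrow.obj z) ⟶ y) :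
    transposeSq (pullbackPushforwardAdj g.hom) (transposeSq (Over.mapPullbackAdj τ.left)
        (beckChevalleyLeftSq τ z ≫ sq)) =
      transposeSq (Over.mapPullbackAdj τ.right)
        (transposeSq (pullbackPushforwardAdj h.hom) sq) ≫ beckChevalleySq τ y :=
  Arrow.hom_ext _ _ (beckChevalley_homEquiv τ sq.left) (beckChevalley_homEquiv τ sq.right)

/-- Choices of fillers against `h_* y` and `g_* s^* y` are compatible with `ψ`. -/
def PushforwardCoherent
    (F : ((Over.map τ.right).mapArrow.obj z ⟶ (pushforward h.hom).mapArrow.obj y) →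
      ((Over.map τ.right).obj z.right ⟶ (pushforward h.hom).obj y.left))
    (F' : (z ⟶ (pushforward g.hom).mapArrow.obj ((Over.pullback τ.left).mapArrow.obj y)) →
      (z.right ⟶ (pushforward g.hom).obj ((Over.pullback τ.left).obj y.left))) : Prop :=
  ∀ sq : z ⟶ (Over.pullback τ.right).mapArrow.obj ((pushforward h.hom).mapArrow.obj y),
    (Over.mapPullbackAdj τ.right).homEquiv _ _
        (F (untransposeSq (Over.mapPullbackAdj τ.right) sq)) ≫ (beckChevalley τ).app y.left =
      F' (sq ≫ beckChevalleySq τ y)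

/-- Choices of fillers from `h^* t_! z` and `g^* z` are compatible with `φ`. -/
def PullbackCoherent
    (F : ((Over.pullback h.hom).mapArrow.obj ((Over.map τ.right).mapArrow.obj z) ⟶ y) →
      ((Over.pullback h.hom).obj ((Over.map τ.right).obj z.right) ⟶ y.left))
    (F' : ((Over.pullback g.hom).mapArrow.obj z ⟶ (Over.pullback τ.left).mapArrow.obj y) →
      ((Over.pullback g.hom).obj z.right ⟶ (Over.pullback τ.left).obj y.left)) : Prop :=
  ∀ sq : (Over.pullback h.hom).mapArrow.obj ((Over.map τ.right).mapArrow.obj z) ⟶ y,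
    (Over.mapPullbackAdj τ.left).homEquiv _ _ ((beckChevalleyLeft τ).app z.right ≫ F sq) =
      F' (transposeSq (Over.mapPullbackAdj τ.left) (beckChevalleyLeftSq τ z ≫ sq))

variable {τ z y}

/-- Every square to be tested is a double transpose of a square out of `h^* t_! z`. On such squares
the mate formula turns compatibility with φ into compatibility with ψ. -/
lemma PullbackCoherent.transpose
    {F : ((Over.pullback h.hom).mapArrow.obj ((Over.map τ.right).mapArrow.obj z) ⟶ y) →
      ((Over.pullback h.hom).obj ((Over.map τ.right).obj z.right) ⟶ y.left)}
    {F' : ((Over.pullback g.hom).mapArrow.obj z ⟶ (Over.pullback τ.left).mapArrow.obj y) →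
      ((Over.pullback g.hom).obj z.right ⟶ (Over.pullback τ.left).obj y.left)}
    (H : PullbackCoherent τ z y F F') :
    PushforwardCoherent τ z y
      (fun sq => (pullbackPushforwardAdj h.hom).homEquiv _ _
        (F (untransposeSq (pullbackPushforwardAdj h.hom) sq)))
      (fun sq => (pullbackPushforwardAdj g.hom).homEquiv _ _
        (F' (untransposeSq (pullbackPushforwardAdj g.hom) sq))) := by
  intro sq
  obtain ⟨sq, rfl⟩ : ∃ sq', sq = transposeSq (Over.mapPullbackAdj τ.right) sq' :=
    ⟨_, (transposeSq_untransposeSq _ sq).symm⟩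
  obtain ⟨sq, rfl⟩ : ∃ sq', sq = transposeSq (pullbackPushforwardAdj h.hom) sq' :=
    ⟨_, (transposeSq_untransposeSq _ sq).symm⟩
  dsimp only
  rw [← beckChevalleySq_transposeSq, untransposeSq_transposeSq, untransposeSq_transposeSq,
    untransposeSq_transposeSq, ← H sq]
  exact (beckChevalley_homEquiv τ _).symm

lemma PushforwardCoherent.untranspose
    {F : ((Over.map τ.right).mapArrow.obj z ⟶ (pushforward h.hom).mapArrow.obj y) →
      ((Over.map τ.right).obj z.right ⟶ (pushforward h.hom).obj y.left)}
    {F' : (z ⟶ (pushforward g.hom).mapArrow.obj ((Over.pullback τ.left).mapArrow.obj y)) →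
      (z.right ⟶ (pushforward g.hom).obj ((Over.pullback τ.left).obj y.left))}
    (H : PushforwardCoherent τ z y F F') :
    PullbackCoherent τ z y
      (fun sq => ((pullbackPushforwardAdj h.hom).homEquiv _ _).symm
        (F (transposeSq (pullbackPushforwardAdj h.hom) sq)))
      (fun sq => ((pullbackPushforwardAdj g.hom).homEquiv _ _).symm
        (F' (transposeSq (pullbackPushforwardAdj g.hom) sq))) := by
  intro sq
  have h := H (transposeSq (Over.mapPullbackAdj τ.right)
    (transposeSq (pullbackPushforwardAdj h.hom) sq))
  rw [untransposeSq_transposeSq, ← beckChevalleySq_transposeSq] at h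
  refine (((pullbackPushforwardAdj g.hom).homEquiv _ _).eq_symm_apply).2 ?_
  refine (beckChevalley_homEquiv τ _).trans (Eq.trans ?_ h)
  exact congrArg (fun z => (Over.mapPullbackAdj τ.right).homEquiv _ _ z ≫ _)
    (Equiv.apply_symm_apply _ _)

end Squares

/-- Fillers of the arrows `u i` against the pushforwards of right maps, compatible with the
Beck–Chevalley transformations. -/
structure PushforwardLifting (u : I ⥤ Arrow E) (v : J ⥤ Arrow E) (w : K ⥤ Arrow E) where
  lift (j : J) : Lifting (Slice.toOver u (v.obj j).right)
    (Slice.toOver (RightMap.forget w) (v.obj j).left ⋙ (pushforward (v.obj j).hom).mapArrow)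
  coherent {j k : J} (τ : j ⟶ k) (x : Slice u (v.obj j).right)
    (y : Slice (RightMap.forget w) (v.obj k).left) :
    PushforwardCoherent (v.map τ) ((Slice.toOver _ _).obj x) ((Slice.toOver _ _).obj y)
      ((lift k).fill ((Slice.map u (v.map τ).right).obj x) y)
      ((lift j).fill x ((pullbackSlice w (v.map τ).left).obj y))

/-- Fillers of the pullbacks of the arrows `u i` against right maps, compatible with the
Beck–Chevalley transformations. -/
structure PullbackLifting (u : I ⥤ Arrow E) (v : J ⥤ Arrow E) (w : K ⥤ Arrow E) where
  lift (j : J) : Lifting (Slice.toOver u (v.obj j).right ⋙ (Over.pullback (v.obj j).hom).mapArrow)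
    (Slice.toOver (RightMap.forget w) (v.obj j).left)
  coherent {j k : J} (τ : j ⟶ k) (x : Slice u (v.obj j).right)
    (y : Slice (RightMap.forget w) (v.obj k).left) :
    PullbackCoherent (v.map τ) ((Slice.toOver _ _).obj x) ((Slice.toOver _ _).obj y)
      ((lift k).fill ((Slice.map u (v.map τ).right).obj x) y)
      ((lift j).fill x ((pullbackSlice w (v.map τ).left).obj y))

variable {u : I ⥤ Arrow E} {v : J ⥤ Arrow E} {w : K ⥤ Arrow E}

/-- Transposition of fillers along the adjunctions between pullback and pushforward. -/
noncomputable def PullbackLifting.transpose (S : PullbackLifting u v w) :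
    PushforwardLifting u v w where
  lift j := (S.lift j).transpose (pullbackPushforwardAdj (v.obj j).hom)
  coherent τ x y := (S.coherent τ x y).transpose

/-- Transposition of fillers along the adjunctions between pullback and pushforward. -/
noncomputable def PushforwardLifting.untranspose (S : PushforwardLifting u v w) :
    PullbackLifting u v w where
  lift j := (S.lift j).untranspose (pullbackPushforwardAdj (v.obj j).hom)
  coherent τ x y := (S.coherent τ x y).untranspose

end PushforwardLifting

/-- The equality of whiskered transformations, read at one object: transports between functors
become transports between objects, and the last one cancels. -/
lemma LiftsNatTrans.exists_app {A : Type u₁} [Category.{v₁} A] {B : Type u₂} [Category.{v₂} B]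
    {C : Type u₃} [Category.{v₃} C] {D : Type u₄} [Category.{v₄} D] {p : A ⥤ C} {q : B ⥤ D}
    {F G : C ⥤ D} {F' G' : A ⥤ B} {hF : IsLift p q F F'} {hG : IsLift p q G G'} {m : F ⟶ G}
    (h : LiftsNatTrans hF hG m) (x : A) : ∃ k : F'.obj x ⟶ G'.obj x,
      q.map k ≫ eqToHom (Functor.congr_obj hG x) =
        eqToHom (Functor.congr_obj hF x) ≫ m.app (p.obj x) := by
  obtain ⟨m', hm⟩ := h
  have hF' : F' ⋙ q = p ⋙ F := hF
  have hG' : G' ⋙ q = p ⋙ G := hG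
  refine ⟨m'.app x, ?_⟩
  have h₁ : q.map (m'.app x) = (eqToHom hF').app x ≫ m.app (p.obj x) ≫ (eqToHom hG'.symm).app x :=
    NatTrans.congr_app hm x
  rw [eqToHom_app, eqToHom_app] at h₁
  rw [h₁, Category.assoc, Category.assoc]
  exact congrArg (_ ≫ ·) ((congrArg (_ ≫ ·) (eqToHom_trans _ _)).trans (Category.comp_id _))

/-! ### Lifted pushforward functors versus coherent fillers -/

section PushforwardFrobenius

variable {E : Type u} [Category.{v} E] [HasPullbacks E]
  {I : Type u₁} [Category.{v₁} I] {J : Type u₂} [Category.{v₂} J] {K : Type u₃} [Category.{v₃} K]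

lemma mapPullbackAdj_homEquiv_left {X Y : E} (t : X ⟶ Y) {Z : Over X} {W : Over Y}
    (f : (Over.map t).obj Z ⟶ W) (h : f.left ≫ W.hom = Z.hom ≫ t) :
    ((Over.mapPullbackAdj t).homEquiv Z W f).left = pullback.lift f.left Z.hom h := by
  rw [Over.mapPullbackAdj, Adjunction.mkOfHomEquiv_homEquiv]
  rfl

lemma mapPullbackAdj_homEquiv_symm_left {X Y : E} (t : X ⟶ Y) {Z : Over X} {W : Over Y}
    (f : Z ⟶ (Over.pullback t).obj W) :
    (((Over.mapPullbackAdj t).homEquiv Z W).symm f).left = f.left ≫ pullback.fst W.hom t := by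
  rw [Over.mapPullbackAdj, Adjunction.mkOfHomEquiv_homEquiv]
  rfl

/-- A map into a pullback is fixed by its projections. For the filler of a pulled-back right map
these are the filler of the original map and the structure map to `X`, and transposition along `t_!
⊣ t^*` produces the same pair. -/
lemma Slice.lifting_fill_pullbackSlice {u : I ⥤ Arrow E} {X Y : E} (t : X ⟶ Y) (x : Slice u X)
    (y : Slice (RightMap.forget u) Y) (sq : (Slice.toOver u X).obj x ⟶
      (Over.pullback t).mapArrow.obj ((Slice.toOver (RightMap.forget u) Y).obj y)) :
    (Slice.lifting u X).fill x ((pullbackSlice u t).obj y) sq =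
      (Over.mapPullbackAdj t).homEquiv ((Slice.toOver u X).obj x).right
        ((Slice.toOver (RightMap.forget u) Y).obj y).left ((Slice.lifting u Y).fill ((Slice.map u t).obj x) y
        (untransposeSq (Over.mapPullbackAdj t) sq)) := by
  have e : overSq sq ≫ baseChangeProj y.i.arrow y.w t =
      overSq (untransposeSq (Over.mapPullbackAdj t) sq) :=
    Arrow.hom_ext _ _ (mapPullbackAdj_homEquiv_symm_left t sq.left).symm
      (mapPullbackAdj_homEquiv_symm_left t sq.right).symm
  refine Over.OverMorphism.ext (Eq.trans ?_ (mapPullbackAdj_homEquiv_left t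
    (Z := ((Slice.toOver u X).obj x).right) (W := ((Slice.toOver (RightMap.forget u) Y).obj y).left)
    ((Slice.lifting u Y).fill ((Slice.map u t).obj x) y
      (untransposeSq (Over.mapPullbackAdj t) sq)) (Over.w _)).symm)
  refine pullback.hom_ext ?_ ?_
  · exact (pullback.lift_fst _ _ _).trans ((congrArg (y.i.fill x.i) e).trans
      (pullback.lift_fst _ _ _).symm)
  · exact (pullback.lift_snd _ _ _).trans ((Over.w sq.right).trans (pullback.lift_snd _ _ _).symm)

variable [HasPushforwards E] {u : I ⥤ Arrow E} {v : J ⥤ Arrow E} {w : K ⥤ Arrow E}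

/-- Here `M` is the lifted ψ, `h₀` describes the fillers of the pulled-back map, and `hF` says that
`M` respects fillers. Conjugating by `e` and `e'` carries this to the actual pushforwards, since
`hM` identifies `M` with ψ. -/
lemma PushforwardCoherent.of_iso {g h : Arrow E} {τ : g ⟶ h} {z : Arrow (Over g.right)}
    {y : Arrow (Over h.left)} {a : Arrow (Over h.right)} {b : Arrow (Over g.right)}
    (e : a ≅ (pushforward h.hom).mapArrow.obj y)
    (e' : b ≅ (pushforward g.hom).mapArrow.obj ((Over.pullback τ.left).mapArrow.obj y))
    (M : (Over.pullback τ.right).mapArrow.obj a ⟶ b)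
    (hM : M ≫ e'.hom = (Over.pullback τ.right).mapArrow.map e.hom ≫ beckChevalleySq τ y)
    {F : ((Over.map τ.right).mapArrow.obj z ⟶ a) → ((Over.map τ.right).obj z.right ⟶ a.left)}
    {F₀ : (z ⟶ (Over.pullback τ.right).mapArrow.obj a) →
      (z.right ⟶ (Over.pullback τ.right).obj a.left)}
    {F' : (z ⟶ b) → (z.right ⟶ b.left)}
    (h₀ : ∀ sq, F₀ sq = (Over.mapPullbackAdj τ.right).homEquiv _ _
      (F (untransposeSq (Over.mapPullbackAdj τ.right) sq)))
    (hF : ∀ sq, F₀ sq ≫ M.left = F' (sq ≫ M)) :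
    PushforwardCoherent τ z y (fun sq => F (sq ≫ e.inv) ≫ e.hom.left)
      (fun sq => F' (sq ≫ e'.inv) ≫ e'.hom.left) := by
  intro sq
  have e₁ : beckChevalleySq τ y ≫ e'.inv =
      (Over.pullback τ.right).mapArrow.map e.inv ≫ M := by
    rw [Iso.comp_inv_eq, Category.assoc, hM, ← Category.assoc, ← Functor.map_comp, e.inv_hom_id,
      CategoryTheory.Functor.map_id, Category.id_comp]
  have e₂ : M.left ≫ e'.hom.left =
      (Over.pullback τ.right).map e.hom.left ≫ (beckChevalley τ).app y.left :=
    congrArg (fun z => Arrow.Hom.left z) hM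
  have e₃ : F' ((sq ≫ beckChevalleySq τ y) ≫ e'.inv) =
      (Over.mapPullbackAdj τ.right).homEquiv _ _
        (F (untransposeSq (Over.mapPullbackAdj τ.right) sq ≫ e.inv)) ≫ M.left := by
    rw [Category.assoc, e₁, ← Category.assoc sq, ← hF, h₀, untransposeSq_comp]
  refine Eq.trans ?_ (congrArg (· ≫ e'.hom.left) e₃).symm
  refine Eq.trans ?_ ((Category.assoc _ _ _).trans (congrArg (_ ≫ ·) e₂)).symm
  refine Eq.trans ?_ (Category.assoc _ _ _)
  exact congrArg (· ≫ _) ((Over.mapPullbackAdj τ.right).homEquiv_naturality_right _ _)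

/-- Lifts of the pushforward functors up to isomorphism determine fillers. -/
noncomputable def PushforwardLifting.ofIso (V : ∀ j : J, Slice (RightMap.forget w) (v.obj j).left ⥤
      Slice (RightMap.forget u) (v.obj j).right)
    (e : ∀ j : J, V j ⋙ Slice.toOver (RightMap.forget u) (v.obj j).right ≅
      Slice.toOver (RightMap.forget w) (v.obj j).left ⋙ (pushforward (v.obj j).hom).mapArrow)
    (H : ∀ {j k : J} (τ : j ⟶ k) (y : Slice (RightMap.forget w) (v.obj k).left),
      ∃ M : (pullbackSlice u (v.map τ).right).obj ((V k).obj y) ⟶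
          (V j).obj ((pullbackSlice w (v.map τ).left).obj y),
        (Slice.toOver (RightMap.forget u) _).map M ≫ (e j).hom.app _ =
          (Over.pullback (v.map τ).right).mapArrow.map ((e k).hom.app y) ≫
            beckChevalleySq (v.map τ) ((Slice.toOver _ _).obj y)) :
    PushforwardLifting u v w where
  lift j := ((Slice.lifting u (v.obj j).right).precomp (𝟭 _) (V j)).retractRight
    (e j).inv (e j).hom (e j).inv_hom_id
  coherent {j k} τ x y := by
    obtain ⟨M, hM⟩ := H τ y
    exact PushforwardCoherent.of_iso ((e k).app y) ((e j).app _)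
      ((Slice.toOver (RightMap.forget u) _).map M) hM
      (Slice.lifting_fill_pullbackSlice (v.map τ).right x ((V k).obj y))
      ((Slice.lifting u (v.obj j).right).natural_right (x := x) M)

lemma PushforwardFrobenius.lifting (h : PushforwardFrobenius u v w) :
    Nonempty (PushforwardLifting u v w) := by
  obtain ⟨V, hV, H⟩ := h
  have hV' (j : J) : V j ⋙ Slice.toOver (RightMap.forget u) (v.obj j).right =
    Slice.toOver (RightMap.forget w) (v.obj j).left ⋙ (pushforward (v.obj j).hom).mapArrow := hV j
  -- A strict lift enters as the isomorphism attached to an equality of functors, so fillers are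
  -- conjugated and never rewritten.
  refine ⟨.ofIso V (fun j => eqToIso (hV' j)) fun {j k} τ y => ?_⟩
  obtain ⟨M, hM⟩ := (H τ).exists_app y
  refine ⟨M, ?_⟩
  have e₁ : (Over.pullback (v.map τ).right).mapArrow.map ((eqToIso (hV' k)).hom.app y) =
      eqToHom (congrArg (Over.pullback (v.map τ).right).mapArrow.obj
        (Functor.congr_obj (hV k) y)) := by
    rw [eqToIso.hom, eqToHom_app, eqToHom_map]
  have e₂ : (eqToIso (hV' j)).hom.app ((pullbackSlice w (v.map τ).left).obj y) =
      eqToHom (Functor.congr_obj (hV j) _) := by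
    rw [eqToIso.hom, eqToHom_app]
  exact (congrArg (_ ≫ ·) e₂).trans (hM.trans (congrArg (· ≫ _) e₁.symm))

/-- Passing from fillers to right maps over `X` and back changes nothing: the slice object recovered
from the square agrees with `x`, by `Lifting.fill_left_congr`. -/
lemma Lifting.lifting_fill_toSlice {X : E} {Y : Type u₂} [Category.{v₂} Y] {r : Y ⥤ Arrow (Over X)}
    (Λ : Lifting (Slice.toOver u X) r) (x : Slice u X) (y : Y)
    (sq : (Slice.toOver u X).obj x ⟶ r.obj y) :
    (Slice.lifting u X).fill x (Λ.toSlice.obj y) sq = Λ.fill x y sq :=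
  Over.OverMorphism.ext (Λ.fill_left_congr (Slice.ofSqHom (overSq sq)) sq
    (Arrow.hom_ext _ _ rfl rfl))

/-- This is the coherence of `S` at the slice object read off from `s`. The auxiliary equalities
rewrite the filler of the pulled-back right map as a transpose. -/
lemma PushforwardLifting.fill_comp (S : PushforwardLifting u v w) {j k : J} (τ : j ⟶ k)
    (y : Slice (RightMap.forget w) (v.obj k).left) (i : I)
    (s : u.obj i ⟶ ((pullbackSlice u (v.map τ).right).obj ((S.lift k).toSlice.obj y)).i.arrow) :
    ((pullbackSlice u (v.map τ).right).obj ((S.lift k).toSlice.obj y)).i.fill i s ≫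
      ((beckChevalley (v.map τ)).app ((Slice.toOver _ _).obj y).left).left =
    ((S.lift j).toSlice.obj ((pullbackSlice w (v.map τ).left).obj y)).i.fill i
      (s ≫ overSq (beckChevalleySq (v.map τ) ((Slice.toOver _ _).obj y))) := by
  let q : Arrow (Over (v.obj j).right) := (Over.pullback (v.map τ).right).mapArrow.obj
    ((pushforward (v.obj k).hom).mapArrow.obj ((Slice.toOver _ _).obj y))
  let s' : u.obj i ⟶ Arrow.mk q.hom.left := s
  have h := congrArg CommaMorphism.left (S.coherent τ (Slice.ofSq s') y (Slice.ofSqHom s'))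
  have h₁ := congrArg CommaMorphism.left (Slice.lifting_fill_pullbackSlice (v.map τ).right
    (Slice.ofSq s') ((S.lift k).toSlice.obj y) (Slice.ofSqHom s'))
  have h₂ := (S.lift k).lifting_fill_toSlice ((Slice.map u (v.map τ).right).obj (Slice.ofSq s')) y
    (untransposeSq (Over.mapPullbackAdj (v.map τ).right)
      (g := (pushforward (v.obj k).hom).mapArrow.obj ((Slice.toOver _ _).obj y))
      (Slice.ofSqHom s'))
  have h₃ := congrArg (fun z => ((Over.mapPullbackAdj (v.map τ).right).homEquiv
    ((Slice.toOver u (v.obj j).right).obj (Slice.ofSq s')).right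
    ((pushforward (v.obj k).hom).obj ((Slice.toOver _ _).obj y).left) z).left) h₂
  refine (congrArg (· ≫ _) (h₁.trans h₃)).trans (h.trans ?_)
  exact (S.lift j).fill_left_congr _ _ (Arrow.hom_ext _ _ rfl rfl)

/-- Fillers against pushforwards determine the data of the pushforward condition. -/
lemma PushforwardLifting.pushforwardFrobenius (S : PushforwardLifting u v w) :
    PushforwardFrobenius u v w := by
  -- `toSlice` leaves underlying arrows unchanged, so the lifts are strict by definition and ψ
  -- itself underlies the lifted transformation.
  refine ⟨fun j => (S.lift j).toSlice, fun j => rfl, fun {j k} τ => ⟨?_, ?_⟩⟩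
  · exact
      { app := fun y =>
          { i :=
              { sq := overSq (beckChevalleySq (v.map τ) ((Slice.toOver _ _).obj y))
                fill_comp := S.fill_comp τ y }
            w := Over.w (beckChevalleySq (v.map τ) ((Slice.toOver _ _).obj y)).right }
        naturality := fun y y' f => Slice.Hom.ext (RightMap.Hom.ext (congrArg overSq
          (((Functor.mapArrowFunctor _ _).map (beckChevalley (v.map τ))).naturality
            ((Slice.toOver _ _).map f)))) }
  · refine NatTrans.ext (funext fun y => ?_)
    exact ((Category.id_comp _).trans (Category.comp_id _)).symm

end PushforwardFrobenius

/-! ### From fillers over slices to fillers in the total category -/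

section Graph

variable {E : Type u} [Category.{v} E] [HasPullbacks E] {K : Type u₃} [Category.{v₃} K]
  {w : K ⥤ Arrow E}

/-- The projection from the pullback of a right map. -/
noncomputable def RightMap.pullbackAlongProj (f : RightMap w) {X Y : E} {a : f.arrow.left ⟶ Y}
    {b : f.arrow.right ⟶ Y} (h : f.arrow.hom ≫ b = a) (p : X ⟶ Y) : f.pullbackAlong h p ⟶ f where
  sq := baseChangeProj f.arrow h p
  fill_comp _ _ := pullback.lift_fst _ _ _

/-- The universal property of the pullback of a right map. -/
noncomputable def RightMap.pullbackAlongLift {g f : RightMap w} (φ : g ⟶ f) {X Y : E}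
    {a : f.arrow.left ⟶ Y} {b : f.arrow.right ⟶ Y} (h : f.arrow.hom ≫ b = a) (p : X ⟶ Y)
    (c : g.arrow.right ⟶ X) (hc : φ.sq.right ≫ b = c ≫ p) : g ⟶ f.pullbackAlong h p where
  sq := Arrow.homMk (g := Arrow.mk (baseChange f.arrow.hom h p))
    (pullback.lift φ.sq.left (g.arrow.hom ≫ c)
      (by rw [← h, Category.assoc, ← hc]; exact Arrow.w_assoc φ.sq b))
    (pullback.lift φ.sq.right c hc) (by
      refine pullback.hom_ext ?_ ?_
      · refine (Category.assoc _ _ _).trans ((congrArg (_ ≫ ·) (baseChange_fst _ h p)).trans ?_)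
        refine (pullback.lift_fst_assoc _ _ _ _).trans ((Arrow.w φ.sq).trans ?_)
        exact (congrArg (_ ≫ ·) (pullback.lift_fst _ _ _).symm).trans (Category.assoc _ _ _).symm
      · refine (Category.assoc _ _ _).trans ((congrArg (_ ≫ ·) (baseChange_snd _ h p)).trans ?_)
        refine (pullback.lift_snd _ _ _).trans ?_
        exact (congrArg (_ ≫ ·) (pullback.lift_snd _ _ _).symm).trans (Category.assoc _ _ _).symm)
  fill_comp i s := by
    refine pullback.hom_ext ?_ ?_
    · refine (Category.assoc _ _ _).trans ((congrArg (_ ≫ ·) (pullback.lift_fst _ _ _)).trans ?_)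
      refine Eq.trans ?_ (pullback.lift_fst _ _ _).symm
      refine (φ.fill_comp i s).trans (congrArg (f.fill i) (Arrow.hom_ext _ _ ?_ ?_))
      · exact (congrArg (s.left ≫ ·) (pullback.lift_fst _ _ _).symm).trans
          (Category.assoc _ _ _).symm
      · exact (congrArg (s.right ≫ ·) (pullback.lift_fst _ _ _).symm).trans
          (Category.assoc _ _ _).symm
    · refine (Category.assoc _ _ _).trans ((congrArg (_ ≫ ·) (pullback.lift_snd _ _ _)).trans ?_)
      refine Eq.trans ?_ (pullback.lift_snd _ _ _).symm
      refine (Category.assoc _ _ _).symm.trans ((congrArg (· ≫ c) (g.fill_hom i s)).trans ?_)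
      exact (congrArg (s.right ≫ ·) (pullback.lift_snd _ _ _).symm).trans
        (Category.assoc _ _ _).symm

/-- For a square from an arrow `m` over `C` to a right map `g`, the pullback of `g` to the codomain
of `m`, as a right map over `C`. -/
noncomputable def Slice.graph {C : E} {m : Arrow (Over C)} (g : RightMap w)
    (sq : Arrow.mk m.hom.left ⟶ g.arrow) : Slice (RightMap.forget w) C where
  i := g.pullbackAlong (b := 𝟙 _) (Category.comp_id _) sq.right
  a := pullback.snd _ _ ≫ m.right.hom
  b := pullback.snd _ _ ≫ m.right.hom
  w := (Category.assoc _ _ _).symm.trans (congrArg (· ≫ m.right.hom)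
    (baseChange_snd g.arrow.hom (Category.comp_id _) sq.right))

/-- The square over `C` induced by a square to a right map. -/
noncomputable def Slice.graphSq {C : E} {m : Arrow (Over C)} (g : RightMap w)
    (sq : Arrow.mk m.hom.left ⟶ g.arrow) :
    m ⟶ (Slice.toOver (RightMap.forget w) C).obj (Slice.graph g sq) :=
  Arrow.homMk
    (Over.homMk (pullback.lift sq.left m.hom.left (Arrow.w sq))
      ((pullback.lift_snd_assoc _ _ _ _).trans (Over.w m.hom)))
    (Over.homMk (pullback.lift sq.right (𝟙 _) ((Category.comp_id _).trans (Category.id_comp _).symm))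
      ((pullback.lift_snd_assoc _ _ _ _).trans (Category.id_comp _)))
    (Over.OverMorphism.ext (by
      refine pullback.hom_ext ?_ ?_
      · refine (Category.assoc _ _ _).trans ((congrArg (_ ≫ ·) (baseChange_fst _ (Category.comp_id _) _)).trans ?_)
        refine (pullback.lift_fst_assoc _ _ _ _).trans ((Arrow.w sq).trans ?_)
        exact (congrArg (_ ≫ ·) (pullback.lift_fst _ _ _).symm).trans (Category.assoc _ _ _).symm
      · refine (Category.assoc _ _ _).trans ((congrArg (_ ≫ ·) (baseChange_snd g.arrow.hom (Category.comp_id _) _)).trans ?_)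
        refine (pullback.lift_snd _ _ _).trans ((Category.comp_id _).symm.trans ?_)
        exact (congrArg (_ ≫ ·) (pullback.lift_snd _ _ _).symm).trans (Category.assoc _ _ _).symm))

section

variable {C C' : E} (s : C ⟶ C') {m : Arrow (Over C)} {m' : Arrow (Over C')}
    (θ : (Over.map s).mapArrow.obj m ⟶ m') {g g' : RightMap w} (γ : g ⟶ g')
    (sq : Arrow.mk m.hom.left ⟶ g.arrow) (sq' : Arrow.mk m'.hom.left ⟶ g'.arrow)
    (h : sq.right ≫ γ.sq.right = θ.right.left ≫ sq'.right)

/-- The functoriality of `Slice.graph`. -/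
noncomputable def Slice.graphMap :
    Slice.graph g sq ⟶ (pullbackSlice w s).obj (Slice.graph g' sq') where
  -- The target is a pullback of a pullback: the inner universal property reaches the pullback of
  -- `g'` along `sq'.right`, the outer one its base change along `s`.
  i := RightMap.pullbackAlongLift
    (RightMap.pullbackAlongLift (RightMap.pullbackAlongProj g _ _ ≫ γ) _ sq'.right
      (pullback.snd _ _ ≫ θ.right.left) (by
        refine (Category.comp_id _).trans (Eq.trans ?_ (Category.assoc _ _ _).symm)
        refine Eq.trans ?_ (congrArg (_ ≫ ·) h)
        refine Eq.trans ?_ (Category.assoc _ _ _)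
        exact congrArg (· ≫ γ.sq.right) ((Category.comp_id _).symm.trans pullback.condition)))
    (Slice.graph g' sq').w s (pullback.snd _ _ ≫ m.right.hom) (by
      refine (pullback.lift_snd_assoc _ _ _ _).trans (Eq.trans ?_ (Category.assoc _ _ _).symm)
      exact (Category.assoc _ _ _).trans (congrArg (_ ≫ ·) (Over.w θ.right)))
  w := pullback.lift_snd _ _ _

/-- Both sides map into iterated pullbacks and are compared on projections: onto `g'` they agree by
`h` and `h'`, onto the codomain of `m'` because `θ` is a square, and onto `C` because all maps lie
over `C`. The transpose appears because the two graphs live over different bases. -/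
lemma Slice.graphSq_graphMap (h' : sq.left ≫ γ.sq.left = θ.left.left ≫ sq'.left) :
    Slice.graphSq g sq ≫ (Slice.toOver _ _).map (Slice.graphMap s θ γ sq sq' h) =
      transposeSq (Over.mapPullbackAdj s) (θ ≫ Slice.graphSq g' sq') := by
  refine Arrow.hom_ext _ _ (Over.OverMorphism.ext ?_) (Over.OverMorphism.ext ?_)
  · refine Eq.trans ?_ (mapPullbackAdj_homEquiv_left s (θ ≫ Slice.graphSq g' sq').left
      (Over.w _)).symm
    refine pullback.hom_ext ?_ ?_
    · refine Eq.trans ?_ (pullback.lift_fst _ _ _).symm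
      refine (Category.assoc _ _ _).trans ((congrArg (_ ≫ ·) (pullback.lift_fst _ _ _)).trans ?_)
      refine pullback.hom_ext ?_ ?_
      · refine (Category.assoc _ _ _).trans ((congrArg (_ ≫ ·) (pullback.lift_fst _ _ _)).trans ?_)
        refine Eq.trans ?_ (Category.assoc _ _ _).symm
        refine Eq.trans ?_ (congrArg (_ ≫ ·) (pullback.lift_fst _ _ _)).symm
        exact (pullback.lift_fst_assoc _ _ _ _).trans h'
      · refine (Category.assoc _ _ _).trans ((congrArg (_ ≫ ·) (pullback.lift_snd _ _ _)).trans ?_)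
        refine Eq.trans ?_ (Category.assoc _ _ _).symm
        refine Eq.trans ?_ (congrArg (_ ≫ ·) (pullback.lift_snd _ _ _)).symm
        refine (congrArg (_ ≫ ·) ((Category.assoc _ _ _).symm.trans
          (congrArg (· ≫ _) (baseChange_snd g.arrow.hom (Category.comp_id _) _)))).trans ?_
        refine (pullback.lift_snd_assoc _ _ _ _).trans ?_
        exact congrArg CommaMorphism.left (Arrow.w θ).symm
    · refine Eq.trans ?_ (pullback.lift_snd _ _ _).symm
      refine (Category.assoc _ _ _).trans ((congrArg (_ ≫ ·) (pullback.lift_snd _ _ _)).trans ?_)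
      refine (congrArg (_ ≫ ·) ((Category.assoc _ _ _).symm.trans
          (congrArg (· ≫ _) (baseChange_snd g.arrow.hom (Category.comp_id _) _)))).trans ?_
      exact (pullback.lift_snd_assoc _ _ _ _).trans (Over.w m.hom)
  · refine Eq.trans ?_ (mapPullbackAdj_homEquiv_left s (θ ≫ Slice.graphSq g' sq').right
      (Over.w _)).symm
    refine pullback.hom_ext ?_ ?_
    · refine Eq.trans ?_ (pullback.lift_fst _ _ _).symm
      refine (Category.assoc _ _ _).trans ((congrArg (_ ≫ ·) (pullback.lift_fst _ _ _)).trans ?_)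
      refine pullback.hom_ext ?_ ?_
      · refine (Category.assoc _ _ _).trans ((congrArg (_ ≫ ·) (pullback.lift_fst _ _ _)).trans ?_)
        refine Eq.trans ?_ (Category.assoc _ _ _).symm
        refine Eq.trans ?_ (congrArg (_ ≫ ·) (pullback.lift_fst _ _ _)).symm
        exact (pullback.lift_fst_assoc _ _ _ _).trans h
      · refine (Category.assoc _ _ _).trans ((congrArg (_ ≫ ·) (pullback.lift_snd _ _ _)).trans ?_)
        refine Eq.trans ?_ (Category.assoc _ _ _).symm
        refine Eq.trans ?_ (congrArg (_ ≫ ·) (pullback.lift_snd _ _ _)).symm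
        refine (pullback.lift_snd_assoc _ _ _ _).trans ?_
        exact (Category.id_comp _).trans (Category.comp_id _).symm
    · refine Eq.trans ?_ (pullback.lift_snd _ _ _).symm
      refine (Category.assoc _ _ _).trans ((congrArg (_ ≫ ·) (pullback.lift_snd _ _ _)).trans ?_)
      exact (pullback.lift_snd_assoc _ _ _ _).trans (Category.id_comp _)

lemma Slice.graphMap_fst :
    (Slice.graphMap s θ γ sq sq' h).i.sq.left ≫ pullback.fst (pullback.snd _ _ ≫ m'.right.hom) s ≫
      pullback.fst g'.arrow.hom sq'.right = pullback.fst g.arrow.hom sq.right ≫ γ.sq.left :=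
  (pullback.lift_fst_assoc _ _ _ _).trans (pullback.lift_fst _ _ _)

end

end Graph

/-! ### Pullbacks over slices compared with the total pullback -/

section TotalLifting

variable {E : Type u} [Category.{v} E] [HasPullbacks E]
  {I : Type u₁} [Category.{v₁} I] {J : Type u₂} [Category.{v₂} J] {K : Type u₃} [Category.{v₃} K]
  {u : I ⥤ Arrow E} {v : J ⥤ Arrow E} {w : K ⥤ Arrow E}

/-- The object of `I_{/E} ×_E J` given by an object of the slice `I_{/X}` over the codomain of
`v j`. -/
def Slice.toTriangle (v : J ⥤ Arrow E) {j : J} (x : Slice u (v.obj j).right) :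
    Triangle u (v ⋙ Arrow.rightFunc) where
  base := j
  i := x.i
  a := x.a
  b := x.b
  w := x.w

/-- The object of the slice over the codomain of `v j` given by an object of `I_{/E} ×_E J`. -/
def Triangle.toSlice (x : Triangle u (v ⋙ Arrow.rightFunc)) : Slice u (v.obj x.base).right where
  i := x.i
  a := x.a
  b := x.b
  w := x.w

/-- The pullback of `u i` along `v j`, as an arrow over the domain of `v j`. -/
noncomputable abbrev Slice.pulledBack {j : J} (x : Slice u (v.obj j).right) :
    Arrow (Over (v.obj j).left) :=
  (Over.pullback (v.obj j).hom).mapArrow.obj ((Slice.toOver u _).obj x)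

/-- The two arrows have the same ends by definition but are built from different maps into a
pullback, one with an extra identity on the second component. Hence the translations `ofTotal` and
`toTotal`, whose sides are identities. -/
lemma Slice.totalPullback_hom {j : J} (x : Slice u (v.obj j).right) :
    ((totalPullback u v).obj (x.toTriangle v)).hom = x.pulledBack.hom.left := by
  refine pullback.hom_ext ?_ ?_
  · exact (pullback.lift_fst _ _ _).trans (pullback.lift_fst _ _ _).symm
  · exact (pullback.lift_snd _ _ _).trans ((Category.comp_id _).trans (pullback.lift_snd _ _ _).symm)

/-- Squares from the total pullback, as squares from an arrow over the domain of `v j`. -/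
noncomputable def Slice.ofTotal {j : J} (x : Slice u (v.obj j).right) :
    Arrow.mk x.pulledBack.hom.left ⟶ (totalPullback u v).obj (x.toTriangle v) :=
  Arrow.homMk (𝟙 _) (𝟙 _) ((Category.id_comp _).trans
    ((Slice.totalPullback_hom x).trans (Category.comp_id _).symm))

/-- Squares from an arrow over the domain of `v j`, as squares from the total pullback. -/
noncomputable def Slice.toTotal {j : J} (x : Slice u (v.obj j).right) :
    (totalPullback u v).obj (x.toTriangle v) ⟶ Arrow.mk x.pulledBack.hom.left :=
  Arrow.homMk (𝟙 _) (𝟙 _) ((Category.id_comp _).trans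
    ((Slice.totalPullback_hom x).symm.trans (Category.comp_id _).symm))

/-- The morphism of arrows over the domain of `v k` underlying a morphism between total
pullbacks. -/
noncomputable def Slice.totalMap {j k : J} (τ : j ⟶ k) {x : Slice u (v.obj j).right}
    {x' : Slice u (v.obj k).right} (f : (Slice.map u (v.map τ).right).obj x ⟶ x') :
    (Over.map (v.map τ).left).mapArrow.obj x.pulledBack ⟶ x'.pulledBack :=
  ((Functor.mapArrowFunctor _ _).map (beckChevalleyLeft (v.map τ))).app ((Slice.toOver u _).obj x) ≫
    (Over.pullback (v.obj k).hom).mapArrow.map ((Slice.toOver u _).map f)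

/-- The square underlying `Slice.totalMap`. -/
noncomputable def Slice.totalSq {j k : J} (τ : j ⟶ k) {x : Slice u (v.obj j).right}
    {x' : Slice u (v.obj k).right} (f : (Slice.map u (v.map τ).right).obj x ⟶ x') :
    Arrow.mk x.pulledBack.hom.left ⟶ Arrow.mk x'.pulledBack.hom.left :=
  overSq (Slice.totalMap τ f)

/-- The morphism in `I_{/E} ×_E J` over `τ` given by a morphism of slices. -/
def Slice.triangleMap {j k : J} (τ : j ⟶ k) {x : Slice u (v.obj j).right}
    {x' : Slice u (v.obj k).right} (f : (Slice.map u (v.map τ).right).obj x ⟶ x') :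
    x.toTriangle v ⟶ x'.toTriangle v where
  base := τ
  i := f.i
  w := f.w

lemma Slice.totalPullback_map {j k : J} (τ : j ⟶ k) {x : Slice u (v.obj j).right}
    {x' : Slice u (v.obj k).right} (f : (Slice.map u (v.map τ).right).obj x ⟶ x') :
    (totalPullback u v).map (Slice.triangleMap τ f) ≫ x'.toTotal =
      x.toTotal ≫ Slice.totalSq τ f := by
  refine Arrow.hom_ext _ _ ?_ ?_
  · refine (Category.comp_id _).trans (Eq.trans ?_ (Category.id_comp _).symm)
    refine pullback.hom_ext ?_ ?_
    · refine (pullback.lift_fst _ _ _).trans (Eq.trans ?_ (Category.assoc _ _ _).symm)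
      refine Eq.trans ?_ (congrArg (_ ≫ ·) (pullback.lift_fst _ _ _)).symm
      refine Eq.trans ?_ (pullback.lift_fst_assoc _ _ _ _).symm
      exact congrArg (· ≫ _) (Category.comp_id _).symm
    · refine (pullback.lift_snd _ _ _).trans (Eq.trans ?_ (Category.assoc _ _ _).symm)
      refine Eq.trans ?_ (congrArg (_ ≫ ·) (pullback.lift_snd _ _ _)).symm
      exact (pullback.lift_snd _ _ _).symm
  · refine (Category.comp_id _).trans (Eq.trans ?_ (Category.id_comp _).symm)
    refine pullback.hom_ext ?_ ?_
    · refine (pullback.lift_fst _ _ _).trans (Eq.trans ?_ (Category.assoc _ _ _).symm)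
      refine Eq.trans ?_ (congrArg (_ ≫ ·) (pullback.lift_fst _ _ _)).symm
      refine Eq.trans ?_ (pullback.lift_fst_assoc _ _ _ _).symm
      exact congrArg (· ≫ _) (Category.comp_id _).symm
    · refine (pullback.lift_snd _ _ _).trans (Eq.trans ?_ (Category.assoc _ _ _).symm)
      refine Eq.trans ?_ (congrArg (_ ≫ ·) (pullback.lift_snd _ _ _)).symm
      exact (pullback.lift_snd _ _ _).symm

end TotalLifting

/-! ### Coherent fillers over slices are fillers for the total pullback -/

section TotalLiftingIff

variable {E : Type u} [Category.{v} E] [HasPullbacks E]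
  {I : Type u₁} [Category.{v₁} I] {J : Type u₂} [Category.{v₂} J] {K : Type u₃} [Category.{v₃} K]
  {u : I ⥤ Arrow E} {v : J ⥤ Arrow E} {w : K ⥤ Arrow E}

lemma Slice.ofTotal_map {j k : J} (τ : j ⟶ k) {x : Slice u (v.obj j).right}
    {x' : Slice u (v.obj k).right} (f : (Slice.map u (v.map τ).right).obj x ⟶ x') :
    x.ofTotal ≫ (totalPullback u v).map (Slice.triangleMap τ f) =
      Slice.totalSq τ f ≫ x'.ofTotal := by
  have e := Slice.totalPullback_map τ f
  refine Arrow.hom_ext _ _ ?_ ?_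
  · exact (Category.id_comp _).trans (((Category.comp_id _).symm.trans ((congrArg
      (fun z => Arrow.Hom.left z) e).trans (Category.id_comp _))).trans (Category.comp_id _).symm)
  · exact (Category.id_comp _).trans (((Category.comp_id _).symm.trans ((congrArg
      (fun z => Arrow.Hom.right z) e).trans (Category.id_comp _))).trans (Category.comp_id _).symm)

lemma overSq_transposeSq {X Y : E} (t : X ⟶ Y) {m : Arrow (Over X)}
    (y : Slice (RightMap.forget w) Y)
    (q : (Over.map t).mapArrow.obj m ⟶ (Slice.toOver (RightMap.forget w) Y).obj y) :
    overSq (transposeSq (Over.mapPullbackAdj t) q) ≫ baseChangeProj y.i.arrow y.w t = overSq q :=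
  Arrow.hom_ext _ _
    ((congrArg (· ≫ _) (mapPullbackAdj_homEquiv_left t q.left (Over.w _))).trans
      (pullback.lift_fst _ _ _))
    ((congrArg (· ≫ _) (mapPullbackAdj_homEquiv_left t q.right (Over.w _))).trans
      (pullback.lift_fst _ _ _))

/-- Not an instance of `Slice.totalPullback_map` at `𝟙 j`: `v.map (𝟙 j)` is an identity only
propositionally, so `f` has the wrong source there. -/
lemma Slice.totalPullback_map_id {j : J} {x x' : Slice u (v.obj j).right} (f : x ⟶ x') :
    ∃ f' : x.toTriangle v ⟶ x'.toTriangle v, (totalPullback u v).map f' ≫ x'.toTotal =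
      x.toTotal ≫ overSq ((Over.pullback (v.obj j).hom).mapArrow.map
        ((Slice.toOver u _).map f)) := by
  refine ⟨⟨𝟙 j, f.i, ?_⟩, ?_⟩
  · refine f.w.trans ((Category.comp_id _).symm.trans (congrArg (x.b ≫ ·) ?_))
    exact ((v ⋙ Arrow.rightFunc).map_id j).symm
  · have hv : (v.map (𝟙 j)).left = 𝟙 _ := congrArg (fun z => Arrow.Hom.left z) (v.map_id j)
    refine Arrow.hom_ext _ _ ?_ ?_
    · refine (Category.comp_id _).trans (Eq.trans ?_ (Category.id_comp _).symm)
      refine pullback.hom_ext ?_ ?_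
      · exact (pullback.lift_fst _ _ _).trans (pullback.lift_fst _ _ _).symm
      · refine (pullback.lift_snd _ _ _).trans (Eq.trans ?_ (pullback.lift_snd _ _ _).symm)
        exact (congrArg (_ ≫ ·) hv).trans (Category.comp_id _)
    · refine (Category.comp_id _).trans (Eq.trans ?_ (Category.id_comp _).symm)
      refine pullback.hom_ext ?_ ?_
      · exact (pullback.lift_fst _ _ _).trans (pullback.lift_fst _ _ _).symm
      · refine (pullback.lift_snd _ _ _).trans (Eq.trans ?_ (pullback.lift_snd _ _ _).symm)
        exact (congrArg (_ ≫ ·) hv).trans (Category.comp_id _)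

variable [HasPushforwards E]

/-- Naturality over `τ` splits into three: `n₁` is naturality in the right map along `graphMap` in
the fibre over `j`, `c` is coherence between the two fibres, and `n₂` is naturality along `f` in the
fibre over `k`. Projecting to `g'` removes the graphs. -/
lemma PullbackLifting.fill_graph_natural (S : PullbackLifting u v w) {j k : J} (τ : j ⟶ k)
    {x : Slice u (v.obj j).right} {x' : Slice u (v.obj k).right}
    (f : (Slice.map u (v.map τ).right).obj x ⟶ x') {g g' : RightMap w} (γ : g ⟶ g')
    (q : Arrow.mk x.pulledBack.hom.left ⟶ g.arrow) (q' : Arrow.mk x'.pulledBack.hom.left ⟶ g'.arrow)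
    (h : q ≫ γ.sq = Slice.totalSq τ f ≫ q') :
    ((S.lift j).fill x (Slice.graph g q) (Slice.graphSq g q)).left ≫
        pullback.fst g.arrow.hom q.right ≫ γ.sq.left =
      (Slice.totalSq τ f).right ≫
        ((S.lift k).fill x' (Slice.graph g' q') (Slice.graphSq g' q')).left ≫
          pullback.fst g'.arrow.hom q'.right := by
  have hl := congrArg (fun z => Arrow.Hom.left z) h
  have hr := congrArg (fun z => Arrow.Hom.right z) h
  let θ := Slice.totalMap τ f
  let φ := Slice.graphMap (v.map τ).left θ γ q q' hr
  have n₁ := (S.lift j).natural_right (x := x) φ (Slice.graphSq g q)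
  rw [Slice.graphSq_graphMap _ θ γ q q' hr hl] at n₁
  have n₂ := (S.lift k).natural_left f (Slice.graphSq g' q')
  have c := S.coherent τ x (Slice.graph g' q')
    ((Over.pullback (v.obj k).hom).mapArrow.map ((Slice.toOver u _).map f) ≫ Slice.graphSq g' q')
  have e : θ ≫ Slice.graphSq g' q' = beckChevalleyLeftSq (v.map τ) ((Slice.toOver _ _).obj x) ≫
      (Over.pullback (v.obj k).hom).mapArrow.map ((Slice.toOver u _).map f) ≫
        Slice.graphSq g' q' := Category.assoc _ _ _
  have n₃ := n₁.trans ((congrArg (fun z => (S.lift j).fill x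
    ((pullbackSlice w (v.map τ).left).obj (Slice.graph g' q'))
      (transposeSq (Over.mapPullbackAdj (v.map τ).left) z)) e).trans c.symm)
  have n₄ := congrArg (fun z => CommaMorphism.left z ≫
    pullback.fst (pullback.snd g'.arrow.hom q'.right ≫ x'.pulledBack.right.hom) (v.map τ).left ≫
      pullback.fst g'.arrow.hom q'.right) n₃
  have n₅ := mapPullbackAdj_homEquiv_left (v.map τ).left
    ((beckChevalleyLeft (v.map τ)).app ((Slice.toOver u _).obj x).right ≫
      (S.lift k).fill ((Slice.map u (v.map τ).right).obj x) (Slice.graph g' q')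
        ((Over.pullback (v.obj k).hom).mapArrow.map ((Slice.toOver u _).map f) ≫
          Slice.graphSq g' q')) (Over.w _)
  have n₆ := (congrArg (_ ≫ ·) (Slice.graphMap_fst (v.map τ).left θ γ q q' hr)).symm.trans
    ((Category.assoc _ _ _).symm.trans n₄)
  refine n₆.trans ?_
  refine (congrArg (· ≫ _) n₅).trans ((pullback.lift_fst_assoc _ _ _ _).trans ?_)
  refine (congrArg (fun z => CommaMorphism.left ((beckChevalleyLeft (v.map τ)).app
    ((Slice.toOver u _).obj x).right ≫ z) ≫ pullback.fst g'.arrow.hom q'.right) n₂).trans ?_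
  refine (congrArg (· ≫ _) (Category.assoc _ _ _).symm).trans ?_
  exact Category.assoc _ _ _

/-- Fillers over slices determine fillers for the total pullback. -/
noncomputable def PullbackLifting.toTotal (S : PullbackLifting u v w) :
    Lifting (totalPullback u v) (RightMap.forget w) where
  -- The right map `g` need not lie over the domain of `v j`, but its graph does; the first
  -- projection leads back to `g`.
  fill X g sq := ((S.lift X.base).fill X.toSlice (Slice.graph g (X.toSlice.ofTotal ≫ sq))
    (Slice.graphSq g (X.toSlice.ofTotal ≫ sq))).left ≫ pullback.fst g.arrow.hom _
  hom_fill X g sq := by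
    have h := congrArg CommaMorphism.left ((S.lift X.base).hom_fill X.toSlice
      (Slice.graph g (X.toSlice.ofTotal ≫ sq)) (Slice.graphSq g (X.toSlice.ofTotal ≫ sq)))
    refine (congrArg (· ≫ _) (Slice.totalPullback_hom X.toSlice)).trans ?_
    refine (Category.assoc _ _ _).symm.trans ((congrArg (· ≫ _) h).trans ?_)
    exact (pullback.lift_fst _ _ _).trans (Category.id_comp _)
  fill_hom X g sq := by
    have h := congrArg CommaMorphism.left ((S.lift X.base).fill_hom X.toSlice
      (Slice.graph g (X.toSlice.ofTotal ≫ sq)) (Slice.graphSq g (X.toSlice.ofTotal ≫ sq)))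
    refine (Category.assoc _ _ _).trans ?_
    refine (congrArg (_ ≫ ·) (baseChange_fst g.arrow.hom (Category.comp_id _) _).symm).trans ?_
    refine (Category.assoc _ _ _).symm.trans ((congrArg (· ≫ _) h).trans ?_)
    exact (pullback.lift_fst _ _ _).trans (Category.id_comp sq.right)
  natural {X X'} f g g' γ sq sq' h := by
    let f' : (Slice.map u (v.map f.base).right).obj X.toSlice ⟶ X'.toSlice := ⟨f.i, f.w⟩
    have e : (totalPullback u v).map f ≫ X'.toSlice.toTotal =
      X.toSlice.toTotal ≫ Slice.totalSq f.base f' := Slice.totalPullback_map f.base f'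
    have e' : X.toSlice.ofTotal ≫ (totalPullback u v).map f =
        Slice.totalSq f.base f' ≫ X'.toSlice.ofTotal := Slice.ofTotal_map f.base f'
    have e₃ := congrArg (fun z => Arrow.Hom.right z) e
    refine (Category.assoc _ _ _).trans ?_
    refine (S.fill_graph_natural f.base f' γ (X.toSlice.ofTotal ≫ sq) (X'.toSlice.ofTotal ≫ sq')
      ?_).trans (congrArg (· ≫ _) ((Category.id_comp _).symm.trans
        (e₃.symm.trans (Category.comp_id _))))
    refine (Category.assoc _ _ _).trans ((congrArg (_ ≫ ·) h).trans ?_)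
    refine (Category.assoc _ _ _).symm.trans ((congrArg (· ≫ sq') e').trans (Category.assoc _ _ _))

/-- Fillers for the total pullback determine fillers over slices. -/
noncomputable def Lifting.overSlice (Λ : Lifting (totalPullback u v) (RightMap.forget w)) (j : J) :
    Lifting (Slice.toOver u (v.obj j).right ⋙ (Over.pullback (v.obj j).hom).mapArrow)
      (Slice.toOver (RightMap.forget w) (v.obj j).left) where
  fill x y sq := Over.homMk (Λ.fill (x.toTriangle v) y.i (x.toTotal ≫ overSq sq)) (by
    have h := Λ.fill_hom (x.toTriangle v) y.i (x.toTotal ≫ overSq sq)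
    refine (congrArg (_ ≫ ·) y.w.symm).trans ((Category.assoc _ _ _).symm.trans ?_)
    refine (congrArg (· ≫ y.b) (h.trans (Category.id_comp sq.right.left))).trans ?_
    exact Over.w sq.right)
  hom_fill x y sq := Over.OverMorphism.ext (by
    have h := Λ.hom_fill (x.toTriangle v) y.i (x.toTotal ≫ overSq sq)
    exact (congrArg (· ≫ _) (Slice.totalPullback_hom x).symm).trans
      (h.trans (Category.id_comp _)))
  fill_hom x y sq := Over.OverMorphism.ext
    ((Λ.fill_hom (x.toTriangle v) y.i (x.toTotal ≫ overSq sq)).trans (Category.id_comp _))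
  natural {x x'} f y y' g sq sq' h := Over.OverMorphism.ext (by
    obtain ⟨f', hf⟩ := Slice.totalPullback_map_id (v := v) f
    have hr := (Category.comp_id _).symm.trans ((congrArg (fun z => Arrow.Hom.right z) hf).trans
      (Category.id_comp _))
    refine (Λ.natural f' g.i (x.toTotal ≫ overSq sq) (x'.toTotal ≫ overSq sq') ?_).trans
      (congrArg (· ≫ _) hr)
    let p : Arrow.mk x.pulledBack.hom.left ⟶ Arrow.mk x'.pulledBack.hom.left :=
      overSq ((Over.pullback (v.obj j).hom).mapArrow.map ((Slice.toOver u _).map f))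
    let q : Arrow.mk x.pulledBack.hom.left ⟶ y.i.arrow := overSq sq
    let q' : Arrow.mk x'.pulledBack.hom.left ⟶ y'.i.arrow := overSq sq'
    have e : q ≫ g.i.sq = p ≫ q' := congrArg overSq h
    have hf' : (totalPullback u v).map f' ≫ x'.toTotal = x.toTotal ≫ p := hf
    exact (Category.assoc x.toTotal q g.i.sq).trans ((congrArg (x.toTotal ≫ ·) e).trans
      ((Category.assoc x.toTotal p q').symm.trans ((congrArg (· ≫ q') hf'.symm).trans
        (Category.assoc _ x'.toTotal q')))))

/-- Fillers for the total pullback determine fillers over slices. -/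
noncomputable def Lifting.toPullbackLifting (Λ : Lifting (totalPullback u v) (RightMap.forget w)) :
    PullbackLifting u v w where
  lift j := Λ.overSlice j
  coherent {j k} τ x y sq := by
    let x' := (Slice.map u (v.map τ).right).obj x
    let q := beckChevalleyLeftSq (v.map τ) ((Slice.toOver _ _).obj x) ≫ sq
    -- After removing the transpose along `s_! ⊣ s^*`, coherence becomes naturality of `Λ` for two
    -- maps: the map of triangles over `τ` that is the identity on `x.i`, and the projection from
    -- the pulled-back right map.
    refine ((Over.mapPullbackAdj (v.map τ).left).homEquiv _ _).eq_symm_apply.1 ?_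
    refine Over.OverMorphism.ext (Eq.trans ?_ (mapPullbackAdj_homEquiv_symm_left (v.map τ).left
      (Z := x.pulledBack.right) (W := ((Slice.toOver _ _).obj y).left)
      ((Λ.overSlice j).fill x ((pullbackSlice w (v.map τ).left).obj y)
        (transposeSq (Over.mapPullbackAdj (v.map τ).left) q))).symm)
    have e := Slice.totalPullback_map τ (𝟙 x')
    have e₀ : Slice.totalMap τ (𝟙 x') =
        beckChevalleyLeftSq (v.map τ) ((Slice.toOver _ _).obj x) :=
      (congrArg (_ ≫ ·) ((congrArg (Over.pullback (v.obj k).hom).mapArrow.map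
        ((Slice.toOver u _).map_id x')).trans (CategoryTheory.Functor.map_id _ _))).trans
        (Category.comp_id _)
    let β : Arrow.mk x.pulledBack.hom.left ⟶ Arrow.mk x'.pulledBack.hom.left :=
      overSq (f := (Over.map (v.map τ).left).mapArrow.obj x.pulledBack)
        (beckChevalleyLeftSq (v.map τ) ((Slice.toOver _ _).obj x))
    have e₁ : Slice.totalSq τ (𝟙 x') = β := congrArg overSq e₀
    have h := Λ.natural (Slice.triangleMap τ (𝟙 x')) (RightMap.pullbackAlongProj y.i y.w
      (v.map τ).left) (x.toTotal ≫ overSq (transposeSq (Over.mapPullbackAdj (v.map τ).left) q))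
      (x'.toTotal ≫ overSq sq) (by
        let p : Arrow.mk x.pulledBack.hom.left ⟶ Arrow.mk (y.i.pullbackAlong y.w
          (v.map τ).left).arrow.hom :=
            overSq (transposeSq (Over.mapPullbackAdj (v.map τ).left) q)
        let q' : Arrow.mk x'.pulledBack.hom.left ⟶ y.i.arrow := overSq sq
        have e₂ : p ≫ baseChangeProj y.i.arrow y.w (v.map τ).left = β ≫ q' :=
          overSq_transposeSq _ y q
        exact (Category.assoc x.toTotal p _).trans ((congrArg (x.toTotal ≫ ·) e₂).trans
          ((Category.assoc x.toTotal β q').symm.trans ((congrArg (· ≫ q')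
            (e.trans (congrArg (x.toTotal ≫ ·) e₁)).symm).trans (Category.assoc _ x'.toTotal q')))))
    refine Eq.trans ?_ h.symm
    have hr := (Category.comp_id _).symm.trans ((congrArg (fun z => Arrow.Hom.right z) e).trans
      (Category.id_comp _))
    rw [e₁] at hr
    exact congrArg (· ≫ _) hr.symm

end TotalLiftingIff

/-! ### The pushforward condition as lifting, and change of generators -/

section PushforwardIff

variable {E : Type u} [Category.{v} E] [HasPullbacks E] [HasPushforwards E]
  {I : Type u₁} [Category.{v₁} I] {J : Type u₂} [Category.{v₂} J] {K : Type u₃} [Category.{v₃} K]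
  {u : I ⥤ Arrow E} {v : J ⥤ Arrow E} {w : K ⥤ Arrow E}

/-- The pushforward condition holds if and only if the pullbacks of the arrows `u i` along the
arrows `v j` lift against right `w`-maps. -/
lemma pushforwardFrobenius_iff :
    PushforwardFrobenius u v w ↔ Nonempty (Lifting (totalPullback u v) (RightMap.forget w)) :=
  ⟨fun h => h.lifting.map fun S => S.untranspose.toTotal,
    fun ⟨Λ⟩ => Λ.toPullbackLifting.transpose.pushforwardFrobenius⟩

variable {I' : Type u₄} [Category.{v₄} I'] {u' : I' ⥤ Arrow E}

/-- A lifting structure of `u'` against right `u`-maps turns right `u`-maps over `X` into right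
`u'`-maps over `X`. -/
def Lifting.sliceMap (Λ : Lifting u' (RightMap.forget u)) (X : E) :
    Slice (RightMap.forget u) X ⥤ Slice (RightMap.forget u') X where
  obj x := ⟨Λ.toRightMap.obj x.i, x.a, x.b, x.w⟩
  map f := ⟨Λ.toRightMap.map f.i, f.w⟩
  map_id x := Slice.Hom.ext (Λ.toRightMap.map_id x.i)
  map_comp f g := Slice.Hom.ext (Λ.toRightMap.map_comp f.i g.i)

/-- Changing right `u`-maps into right `u'`-maps commutes with pullback. -/
noncomputable def Lifting.pullbackAlongToRightMap (Λ : Lifting u' (RightMap.forget u))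
    (f : RightMap u) {X Y : E} {a : f.arrow.left ⟶ Y} {b : f.arrow.right ⟶ Y}
    (w : f.arrow.hom ≫ b = a) (h : X ⟶ Y) :
    (Λ.toRightMap.obj f).pullbackAlong w h ⟶ Λ.toRightMap.obj (f.pullbackAlong w h) where
  sq := 𝟙 (Arrow.mk (baseChange f.arrow.hom w h))
  fill_comp i s := by
    refine (Category.comp_id _).trans (Eq.trans ?_ (congrArg (Λ.fill i (f.pullbackAlong w h))
      (Category.comp_id (Y := Arrow.mk (baseChange f.arrow.hom w h)) s).symm))
    refine pullback.hom_ext (f := a) (g := h) ?_ ?_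
    · exact (pullback.lift_fst _ _ _).trans
        (Λ.natural_right (f.pullbackAlongProj w h) s).symm
    · refine (pullback.lift_snd _ _ _).trans ?_
      have e : Λ.fill i (f.pullbackAlong w h) s ≫ baseChange f.arrow.hom w h = s.right :=
        Λ.fill_hom i (f.pullbackAlong w h) s
      refine (congrArg (· ≫ pullback.snd b h) e.symm).trans ((Category.assoc _ _ _).trans ?_)
      exact congrArg (_ ≫ ·) (baseChange_snd f.arrow.hom w h)

/-- The comparison between `sliceMap` and pullback. -/
noncomputable def Lifting.sliceMapPullback (Λ : Lifting u' (RightMap.forget u)) {X Y : E}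
    (h : X ⟶ Y) :
    Λ.sliceMap Y ⋙ pullbackSlice u' h ⟶ pullbackSlice u h ⋙ Λ.sliceMap X where
  app x :=
    { i := Λ.pullbackAlongToRightMap x.i x.w h
      w := Category.id_comp _ }
  naturality _ _ _ := Slice.Hom.ext (RightMap.Hom.ext
    ((Category.comp_id _).trans (Category.id_comp _).symm))

/-- The pushforward condition depends on `u` only through right `u`-maps. -/
lemma PushforwardFrobenius.of_lifting (h : PushforwardFrobenius u v w)
    (Λ : Lifting u' (RightMap.forget u)) : PushforwardFrobenius u' v w := by
  obtain ⟨V, hV, H⟩ := h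
  refine ⟨fun j => V j ⋙ Λ.sliceMap _, fun j => hV j, fun {j k} τ => ?_⟩
  obtain ⟨m, hm⟩ := H τ
  -- The comparison between change of generators and pullback is an identity on underlying squares,
  -- so the composite still lies over ψ.
  refine ⟨Functor.whiskerLeft (V k) (Λ.sliceMapPullback (v.map τ).right) ≫
    Functor.whiskerRight m (Λ.sliceMap _), Eq.trans ?_ hm⟩
  exact NatTrans.ext (funext fun y => Arrow.hom_ext _ _
    (Over.OverMorphism.ext (Category.id_comp _)) (Over.OverMorphism.ext (Category.id_comp _)))

end PushforwardIff

/-! ### Coalgebras and algebras from lifting structures -/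

section Algebras

variable {E : Type u} [Category.{v} E] {X : Type u₁} [Category.{v₁} X] {Y : Type u₂}
  [Category.{v₂} Y]

namespace AWFS

variable (A : AWFS E)

/-- Coalgebras lift against algebras. -/
def lifting : Lifting A.LcoalgForget A.RalgForget where
  fill c a sq := c.obj.str.right ≫ A.F.Z.map sq ≫ a.obj.str.left
  hom_fill c a sq := by
    have h₁ : c.obj.str.left ≫ A.F.i.app c.obj.V = c.obj.V.hom ≫ c.obj.str.right :=
      Arrow.w c.obj.str
    -- The counit law makes the left side of the coalgebra structure an identity.
    have h₂ : c.obj.str.left ≫ 𝟙 _ = 𝟙 _ := congrArg (fun z => Arrow.Hom.left z) c.property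
    have h₃ : A.F.i.app a.obj.a ≫ a.obj.str.left = 𝟙 _ :=
      congrArg (fun z => Arrow.Hom.left z) a.property
    have h₄ : sq.left ≫ A.F.i.app a.obj.a = A.F.i.app c.obj.V ≫ A.F.Z.map sq :=
      A.F.i.naturality (X := c.obj.V) (Y := a.obj.a) sq
    have h₅ : c.obj.V.hom ≫ c.obj.str.right = A.F.i.app c.obj.V := by
      refine h₁.symm.trans ?_
      rw [(Category.comp_id _).symm.trans h₂]
      exact Category.id_comp _
    refine (Category.assoc _ _ _).symm.trans ((congrArg (· ≫ _) h₅).trans ?_)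
    refine (Category.assoc _ _ _).symm.trans ((congrArg (· ≫ _) h₄.symm).trans ?_)
    exact (Category.assoc _ _ _).trans ((congrArg (_ ≫ ·) h₃).trans (Category.comp_id _))
  fill_hom c a sq := by
    have h₁ : a.obj.str.left ≫ a.obj.a.hom = A.F.p.app a.obj.a ≫ a.obj.str.right :=
      Arrow.w a.obj.str
    have h₂ : 𝟙 _ ≫ a.obj.str.right = 𝟙 _ := congrArg (fun z => Arrow.Hom.right z) a.property
    have h₃ : c.obj.str.right ≫ A.F.p.app c.obj.V = 𝟙 _ :=
      congrArg (fun z => Arrow.Hom.right z) c.property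
    have h₄ : A.F.Z.map sq ≫ A.F.p.app a.obj.a = A.F.p.app c.obj.V ≫ sq.right :=
      A.F.p.naturality (X := c.obj.V) (Y := a.obj.a) sq
    have h₅ : a.obj.str.left ≫ a.obj.a.hom = A.F.p.app a.obj.a := by
      refine h₁.trans ?_
      rw [(Category.id_comp _).symm.trans h₂]
      exact Category.comp_id _
    refine (Category.assoc _ _ _).trans ((congrArg (_ ≫ ·) ((Category.assoc _ _ _).trans
      ((congrArg (_ ≫ ·) h₅).trans h₄))).trans ?_)
    exact (Category.assoc _ _ _).symm.trans ((congrArg (· ≫ _) h₃).trans (Category.id_comp _))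
  natural {c c'} f {a a'} g sq sq' h := by
    have h₁ : c.obj.str.right ≫ A.F.Z.map f.hom.f = f.hom.f.right ≫ c'.obj.str.right :=
      congrArg (fun z => Arrow.Hom.right z) f.hom.h
    have h₂ : A.F.Z.map g.hom.f ≫ a'.obj.str.left = a.obj.str.left ≫ g.hom.f.left :=
      congrArg (fun z => Arrow.Hom.left z) g.hom.h
    have h₃ : A.F.Z.map sq ≫ A.F.Z.map g.hom.f = A.F.Z.map f.hom.f ≫ A.F.Z.map sq' :=
      (A.F.Z.map_comp _ _).symm.trans ((congrArg A.F.Z.map h).trans (A.F.Z.map_comp _ _))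
    change (c.obj.str.right ≫ A.F.Z.map sq ≫ a.obj.str.left) ≫ g.hom.f.left =
      f.hom.f.right ≫ c'.obj.str.right ≫ A.F.Z.map sq' ≫ a'.obj.str.left
    refine Eq.trans ?_ (Category.assoc _ _ _)
    refine Eq.trans ?_ (congrArg (· ≫ _) h₁)
    refine (Category.assoc _ _ _).trans (Eq.trans ?_ (Category.assoc _ _ _).symm)
    refine congrArg (_ ≫ ·) ?_
    refine (Category.assoc _ _ _).trans ((congrArg (_ ≫ ·) h₂.symm).trans ?_)
    exact (Category.assoc _ _ _).symm.trans ((congrArg (· ≫ _) h₃).trans (Category.assoc _ _ _))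

/-- The coalgebras given by a lifting structure against algebras for the monad. -/
def coalgOfLifting {G : X ⥤ Arrow E} (Λ : Lifting G A.RAlgForget) : X ⥤ A.Lcoalg where
  obj x :=
    { obj :=
        { V := G.obj x
          -- The nontrivial side fills the unit square from `G x` to its free algebra. The upper
          -- triangle makes it a map to `L (G x)`, the lower one is the counit law, and naturality
          -- uses that free algebras are functorial.
          str := Arrow.homMk (g := A.F.L.obj (G.obj x)) (𝟙 _)
            (Λ.fill x (A.monad.free.obj (G.obj x)) (A.F.η.app (G.obj x)))
            ((Category.id_comp _).trans
              (Λ.hom_fill x (A.monad.free.obj (G.obj x)) (A.F.η.app (G.obj x))).symm) }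
      property := Arrow.hom_ext _ _ (Category.id_comp _)
        (Λ.fill_hom x (A.monad.free.obj (G.obj x)) (A.F.η.app (G.obj x))) }
  map {x x'} f := ⟨
    { f := G.map f
      h := Arrow.hom_ext _ _ ((Category.id_comp _).trans (Category.comp_id _).symm)
        (Λ.natural f (A.monad.free.map (G.map f)) (A.F.η.app (G.obj x)) (A.F.η.app (G.obj x'))
          (A.F.η.naturality (G.map f)).symm) }⟩
  map_id x := ObjectProperty.hom_ext _ (Endofunctor.Coalgebra.Hom.ext (G.map_id x))
  map_comp f g := ObjectProperty.hom_ext _ (Endofunctor.Coalgebra.Hom.ext (G.map_comp f g))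

/-- The cofree coalgebra on an arrow. -/
def cofree : Arrow E ⥤ A.Lcoalg where
  obj f := ⟨⟨A.F.L.obj f, A.δ.app f⟩, A.left_counit f⟩
  map a := ⟨⟨A.F.L.map a, (A.δ.naturality a).symm⟩⟩
  map_id f := ObjectProperty.hom_ext _ (Endofunctor.Coalgebra.Hom.ext (A.F.L.map_id f))
  map_comp a b := ObjectProperty.hom_ext _ (Endofunctor.Coalgebra.Hom.ext (A.F.L.map_comp a b))

/-- The algebras given by a lifting structure of coalgebras. -/
def algOfLifting {r : Y ⥤ Arrow E} (Λ : Lifting A.LcoalgForget r) : Y ⥤ A.Ralg where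
  obj y :=
    { obj :=
        { a := r.obj y
          -- Dually, the filler of the counit square from the cofree coalgebra to `r y`.
          str := Arrow.homMk (f := A.F.R.obj (r.obj y))
            (Λ.fill (A.cofree.obj (r.obj y)) y (A.F.ε.app (r.obj y))) (𝟙 _)
            ((Λ.fill_hom (A.cofree.obj (r.obj y)) y (A.F.ε.app (r.obj y))).trans
              (Category.comp_id _).symm) }
      property := Arrow.hom_ext _ _
        (Λ.hom_fill (A.cofree.obj (r.obj y)) y (A.F.ε.app (r.obj y))) (Category.id_comp _) }
  map {y y'} g := ⟨
    { f := r.map g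
      h := Arrow.hom_ext _ _
        (Λ.natural (A.cofree.map (r.map g)) g (A.F.ε.app (r.obj y)) (A.F.ε.app (r.obj y'))
          (A.F.ε.naturality (r.map g)).symm).symm
        ((Category.comp_id _).trans (Category.id_comp _).symm) }⟩
  map_id y := ObjectProperty.hom_ext _ (Endofunctor.Algebra.Hom.ext (r.map_id y))
  map_comp f g := ObjectProperty.hom_ext _ (Endofunctor.Algebra.Hom.ext (r.map_comp f g))

/-- Algebras for the monad are algebras for the pointed endofunctor. -/
def algOfAlg : A.RAlg ⥤ A.Ralg where
  obj a := ⟨⟨a.A, a.a⟩, a.unit⟩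
  map f := ⟨⟨f.f, f.h⟩⟩

/-- The free algebra for the monad on the underlying arrow of an algebra. -/
def freeAlg : A.Ralg ⥤ A.RAlg :=
  A.RalgForget ⋙ A.monad.free

/-- An algebra for the pointed endofunctor is a retract of a free algebra. -/
def toFreeAlg : A.RalgForget ⟶ A.freeAlg ⋙ A.RAlgForget where
  app a := A.F.η.app a.obj.a
  naturality _ _ f := A.F.η.naturality f.hom.f

/-- An algebra for the pointed endofunctor is a retract of a free algebra. -/
def ofFreeAlg : A.freeAlg ⋙ A.RAlgForget ⟶ A.RalgForget where
  app a := a.obj.str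
  naturality _ _ f := f.hom.h

end AWFS

end Algebras

/-! ### Pulling an algebra back to the codomain of a generator -/

section Cospans

variable {E : Type u} [Category.{v} E] [HasPullbacks E] {I : Type u₁} [Category.{v₁} I]
  {J : Type u₂} [Category.{v₂} J] {X : Type u₃} [Category.{v₃} X]

/-- Reindexing of `I_{/E} ×_E J` along a functor into `J`. -/
def Triangle.reindex (u : I ⥤ Arrow E) (v : J ⥤ Arrow E) (F : X ⥤ J) :
    Triangle u ((F ⋙ v) ⋙ Arrow.rightFunc) ⥤ Triangle u (v ⋙ Arrow.rightFunc) where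
  obj x := ⟨F.obj x.base, x.i, x.a, x.b, x.w⟩
  map f := ⟨F.map f.base, f.i, f.w⟩
  map_id x := Triangle.Hom.ext (F.map_id x.base) rfl
  map_comp f g := Triangle.Hom.ext (F.map_comp f.base g.base) rfl

/-- The functor sending an arrow `u i : A ⟶ B` over the codomain `D` of `v j : C ⟶ D` to the
projection `B ×_D C ⟶ B`. -/
noncomputable def Triangle.projection (u : I ⥤ Arrow E) (v : J ⥤ Arrow E) :
    Triangle u (v ⋙ Arrow.rightFunc) ⥤ Arrow E where
  obj x := Arrow.mk (pullback.fst x.b (v.obj x.base).hom)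
  map {x y} f := Arrow.homMk
    (pullback.map x.b (v.obj x.base).hom y.b (v.obj y.base).hom (u.map f.i).right
      (v.map f.base).left (v.map f.base).right f.w.symm (Arrow.w (v.map f.base)).symm)
    (u.map f.i).right (pullback.lift_fst _ _ _)
  map_id x := Arrow.hom_ext _ _ (pullback.hom_ext
    ((pullback.lift_fst _ _ _).trans ((congrArg (_ ≫ ·)
      (Arrow.hom.congr_right (u.map_id x.i))).trans
        ((Category.comp_id _).trans (Category.id_comp _).symm)))
    ((pullback.lift_snd _ _ _).trans ((congrArg (_ ≫ ·)
      (Arrow.hom.congr_left (v.map_id x.base))).trans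
        ((Category.comp_id _).trans (Category.id_comp _).symm))))
    (show (u.map (𝟙 x.i)).right = 𝟙 (u.obj x.i).right from Arrow.hom.congr_right (u.map_id x.i))
  map_comp f g := Arrow.hom_ext _ _
    (lift_comp_lift (Arrow.hom.congr_right (u.map_comp f.i g.i)).symm
      (Arrow.hom.congr_left (v.map_comp f.base g.base)).symm _ _ _)
    (show (u.map (f.i ≫ g.i)).right = (u.map f.i).right ≫ (u.map g.i).right from
      Arrow.hom.congr_right (u.map_comp f.i g.i))

/-- The pullback square of `v j` along an arrow into its codomain. -/
noncomputable def Triangle.projectionSq {u : I ⥤ Arrow E} {v : J ⥤ Arrow E}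
    (x : Triangle u (v ⋙ Arrow.rightFunc)) : (Triangle.projection u v).obj x ⟶ v.obj x.base :=
  Arrow.homMk (f := Arrow.mk (pullback.fst x.b (v.obj x.base).hom))
    (pullback.snd x.b (v.obj x.base).hom) x.b pullback.condition.symm

lemma Triangle.projectionSq_natural {u : I ⥤ Arrow E} {v : J ⥤ Arrow E}
    {x y : Triangle u (v ⋙ Arrow.rightFunc)} (f : x ⟶ y) :
    (Triangle.projection u v).map f ≫ y.projectionSq = x.projectionSq ≫ v.map f.base :=
  Arrow.hom_ext _ _ (pullback.lift_snd _ _ _) f.w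

/-- Lifting structures are stable under pullback of the right family. -/
noncomputable def Lifting.projection {G : X ⥤ Arrow E} {v : J ⥤ Arrow E} (Λ : Lifting G v)
    (u : I ⥤ Arrow E) : Lifting G (Triangle.projection u v) where
  fill c x sq := pullback.lift (f := x.b) (g := (v.obj x.base).hom) sq.right
    (Λ.fill c x.base (sq ≫ x.projectionSq))
    (Λ.fill_hom c x.base (sq ≫ x.projectionSq)).symm
  hom_fill c x sq := pullback.hom_ext (f := x.b) (g := (v.obj x.base).hom)
    ((Category.assoc _ _ _).trans ((congrArg (_ ≫ ·) (pullback.lift_fst _ _ _)).trans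
      (Arrow.w sq).symm))
    ((Category.assoc _ _ _).trans ((congrArg (_ ≫ ·) (pullback.lift_snd _ _ _)).trans
      (Λ.hom_fill c x.base (sq ≫ x.projectionSq))))
  fill_hom c x sq := pullback.lift_fst _ _ _
  natural {c c'} f {x x'} g sq sq' h := by
    refine pullback.hom_ext (f := x'.b) (g := (v.obj x'.base).hom) ?_ ?_
    · refine (Category.assoc _ _ _).trans ((congrArg (_ ≫ ·) (pullback.lift_fst _ _ _)).trans ?_)
      refine (pullback.lift_fst_assoc _ _ _ _).trans (Eq.trans ?_ (Category.assoc _ _ _).symm)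
      exact (congrArg (fun z => Arrow.Hom.right z) h).trans
        (congrArg (_ ≫ ·) (pullback.lift_fst _ _ _).symm)
    · refine (Category.assoc _ _ _).trans ((congrArg (_ ≫ ·) (pullback.lift_snd _ _ _)).trans ?_)
      refine (pullback.lift_snd_assoc _ _ _ _).trans (Eq.trans ?_ (Category.assoc _ _ _).symm)
      refine Eq.trans ?_ (congrArg (_ ≫ ·) (pullback.lift_snd _ _ _).symm)
      refine Λ.natural f g.base _ (sq' ≫ x'.projectionSq) ?_
      rw [Category.assoc, ← Triangle.projectionSq_natural, ← Category.assoc, h, Category.assoc]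

end Cospans

/-! ### Iterated pullbacks and pullbacks along isomorphisms -/

section IteratedPullback

variable {E : Type u} [Category.{v} E] [HasPullbacks E]

section

variable {A B C D : E} {g : A ⟶ B} {a : A ⟶ D} {b : B ⟶ D} (w : g ≫ b = a) (h : C ⟶ D)

/-- The pullback `h^* g : A ×_D C ⟶ B ×_D C` of an arrow `g : A ⟶ B` over `D`. -/
noncomputable abbrev pulledBackArrow : Arrow E :=
  Arrow.mk (pullback.map a h b h g (𝟙 _) (𝟙 _) ((Category.comp_id _).trans w.symm)
    ((Category.comp_id _).trans (Category.id_comp _).symm))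

/-- The arrow `A ×_D C ⟶ B ×_D C` maps to the pullback of `g : A ⟶ B` along `B ×_D C ⟶ B`. -/
noncomputable def toIteratedPullback :
    pulledBackArrow w h ⟶ Arrow.mk (pullback.snd (g ≫ 𝟙 B) (pullback.fst b h)) :=
  Arrow.homMk (pullback.lift (pullback.fst a h) (pulledBackArrow w h).hom
      ((congrArg (_ ≫ ·) (Category.comp_id g)).trans (pullback.lift_fst _ _ _).symm))
    (𝟙 _) ((pullback.lift_snd _ _ _).trans (Category.comp_id _).symm)

/-- The pullback of `g : A ⟶ B` along `B ×_D C ⟶ B` maps to the arrow `A ×_D C ⟶ B ×_D C`. -/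
noncomputable def ofIteratedPullback :
    Arrow.mk (pullback.snd (g ≫ 𝟙 B) (pullback.fst b h)) ⟶ pulledBackArrow w h :=
  have e : pullback.fst (g ≫ 𝟙 B) (pullback.fst b h) ≫ g =
      pullback.snd (g ≫ 𝟙 B) (pullback.fst b h) ≫ pullback.fst b h :=
    (congrArg (_ ≫ ·) (Category.comp_id g).symm).trans pullback.condition
  Arrow.homMk (pullback.lift (f := a) (g := h) (pullback.fst _ _)
      (pullback.snd _ _ ≫ pullback.snd b h) (by
        rw [← w, reassoc_of% e, Category.assoc, pullback.condition]))
    (𝟙 _) (by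
      refine Eq.trans ?_ (Category.comp_id _).symm
      refine pullback.hom_ext ((Category.assoc _ _ _).trans ?_) ((Category.assoc _ _ _).trans ?_)
      · refine (congrArg (_ ≫ ·) (pullback.lift_fst _ _ _)).trans ?_
        exact (pullback.lift_fst_assoc _ _ _ _).trans e
      · refine (congrArg (_ ≫ ·) (pullback.lift_snd _ _ _)).trans ?_
        exact (congrArg (_ ≫ ·) (Category.comp_id _)).trans (pullback.lift_snd _ _ _))

/-- One composite is enough, because lifting structures pass to retracts. The factor `𝟙 B` is the
transport in the leg of a cospan whose codomains coincide by definition. -/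
lemma toIteratedPullback_ofIteratedPullback :
    toIteratedPullback w h ≫ ofIteratedPullback w h = 𝟙 _ :=
  Arrow.hom_ext _ _ (pullback.hom_ext
    ((Category.assoc _ _ _).trans ((congrArg (_ ≫ ·) (pullback.lift_fst _ _ _)).trans
      ((pullback.lift_fst _ _ _).trans (Category.id_comp _).symm)))
    ((Category.assoc _ _ _).trans ((congrArg (_ ≫ ·) (pullback.lift_snd _ _ _)).trans
      ((pullback.lift_snd_assoc _ _ _ _).trans ((pullback.lift_snd _ _ _).trans
        ((Category.comp_id _).trans (Category.id_comp _).symm))))))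
    (Category.id_comp _)

end

section

variable {A B C D : E} (g : A ⟶ B) (h : C ⟶ D) (e : B ≅ D)

/-- The pullback `A ×_D C ⟶ C` maps to `A ×_D C ⟶ B ×_D C` for an isomorphism from `B` to `D`. -/
noncomputable def toPullbackIso :
    Arrow.mk (pullback.snd (g ≫ e.hom) h) ⟶ pulledBackArrow (g := g) (b := e.hom) rfl h :=
  Arrow.homMk (𝟙 _) (pullback.lift (h ≫ e.inv) (𝟙 _) (by simp)) (by
    refine (Category.id_comp _).trans (pullback.hom_ext ?_ ?_)
    · refine (pullback.lift_fst _ _ _).trans (Eq.trans ?_ (Category.assoc _ _ _).symm)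
      refine Eq.trans ?_ (congrArg (_ ≫ ·) (pullback.lift_fst _ _ _).symm)
      refine Eq.trans ?_ (Category.assoc _ _ _)
      exact ((Iso.eq_comp_inv _).2 ((Category.assoc _ _ _).trans pullback.condition))
    · refine (pullback.lift_snd _ _ _).trans (Eq.trans ?_ (Category.assoc _ _ _).symm)
      exact congrArg (_ ≫ ·) (pullback.lift_snd _ _ _).symm)

/-- The arrow `A ×_D C ⟶ B ×_D C` maps to `A ×_D C ⟶ C` for an isomorphism from `B` to `D`. -/
noncomputable def ofPullbackIso :
    pulledBackArrow (g := g) (b := e.hom) rfl h ⟶ Arrow.mk (pullback.snd (g ≫ e.hom) h) :=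
  Arrow.homMk (𝟙 _) (pullback.snd _ _) ((Category.id_comp _).trans
    ((Category.comp_id _).symm.trans (pullback.lift_snd _ _ _).symm))

lemma toPullbackIso_ofPullbackIso : toPullbackIso g h e ≫ ofPullbackIso g h e = 𝟙 _ :=
  Arrow.hom_ext _ _ (Category.id_comp _) (pullback.lift_snd _ _ _)

end

end IteratedPullback

/-! ### The Frobenius conditions of an awfs as lifting structures -/

section FrobeniusLifting

variable {E : Type u} [Category.{v} E] [HasPullbacks E] {I : Type u₁} [Category.{v₁} I]
  {J : Type u₂} [Category.{v₂} J] {Y : Type u₃} [Category.{v₃} Y]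

namespace AWFS

variable {A : AWFS E}

/-- Coalgebras lift against algebras; conversely, fillers against free algebras are coalgebra
structures. -/
lemma generalizedFrobenius_iff {u : I ⥤ Arrow E} {v : J ⥤ Arrow E} :
    GeneralizedFrobenius u v A.LcoalgForget ↔
      Nonempty (Lifting (totalPullback u v) A.RAlgForget) :=
  ⟨fun h => h.lifting (A.lifting.precomp (𝟭 _) A.algOfAlg),
    fun ⟨Λ⟩ => .of_lift (A.coalgOfLifting Λ) rfl⟩

/-- The functor `L-coalg ×_E R-alg ⥤ E^→` sending `(g, h)` to `h^* g`. -/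
noncomputable abbrev frobeniusPullback (A : AWFS E) :
    StrictPullback (A.LcoalgForget ⋙ Arrow.rightFunc) (A.RalgForget ⋙ Arrow.rightFunc) ⥤ Arrow E :=
  StrictPullback.map A.LcoalgForget A.RalgForget Arrow.rightFunc Arrow.rightFunc ⋙ pullbackP

lemma functorialFrobenius_iff :
    A.FunctorialFrobenius ↔ Nonempty (Lifting A.frobeniusPullback A.RAlgForget) := by
  refine ⟨fun ⟨F, hF⟩ => ?_, fun ⟨Λ⟩ => ⟨A.coalgOfLifting Λ, rfl⟩⟩
  have e : F ⋙ A.LcoalgForget = A.frobeniusPullback := hF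
  rw [← e]
  exact ⟨A.lifting.precomp F A.algOfAlg⟩

/-- The cospan of a coalgebra and an algebra given by an arrow `u i : A ⟶ B` over the codomain `D`
of an algebra `C ⟶ D`: it consists of `u i` and of the projection `B ×_D C ⟶ B`. -/
noncomputable def cospan {u : I ⥤ Arrow E} {v : J ⥤ Arrow E} (Λ : Lifting u A.RAlgForget)
    (M : Lifting A.LcoalgForget v) : Triangle u (v ⋙ Arrow.rightFunc) ⥤
      StrictPullback (A.LcoalgForget ⋙ Arrow.rightFunc) (A.RalgForget ⋙ Arrow.rightFunc) where
  -- Fillers against coalgebras survive pullback of the right arrow, so the projection carries an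
  -- algebra structure for the pointed endofunctor. The codomains agree definitionally.
  obj x := ⟨(A.coalgOfLifting Λ).obj x.i, (A.algOfLifting (M.projection u)).obj x, rfl⟩
  map f := ⟨(A.coalgOfLifting Λ).map f.i, (A.algOfLifting (M.projection u)).map f,
    (Category.comp_id _).trans (Category.id_comp _).symm⟩
  map_id _ := StrictPullback.Hom.ext ((A.coalgOfLifting Λ).map_id _)
    ((A.algOfLifting (M.projection u)).map_id _)
  map_comp _ _ := StrictPullback.Hom.ext ((A.coalgOfLifting Λ).map_comp _ _)
    ((A.algOfLifting (M.projection u)).map_comp _ _)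

/-- The comparison of `A ×_D C ⟶ B ×_D C` with `A ×_B (B ×_D C) ⟶ B ×_D C`. -/
noncomputable def toCospan {u : I ⥤ Arrow E} {v : J ⥤ Arrow E} (Λ : Lifting u A.RAlgForget)
    (M : Lifting A.LcoalgForget v) :
    totalPullback u v ⟶ cospan Λ M ⋙ A.frobeniusPullback where
  app x := toIteratedPullback x.w (v.obj x.base).hom
  naturality _ _ f := Arrow.hom_ext _ _ (pullback.hom_ext
    ((Category.assoc _ _ _).trans ((congrArg (_ ≫ ·) (pullback.lift_fst _ _ _)).trans
      ((pullback.lift_fst _ _ _).trans ((pullback.lift_fst_assoc _ _ _ _).symm.trans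
        ((congrArg (_ ≫ ·) (pullback.lift_fst _ _ _).symm).trans (Category.assoc _ _ _).symm)))))
    ((Category.assoc _ _ _).trans ((congrArg (_ ≫ ·) (pullback.lift_snd _ _ _)).trans
      ((Arrow.w ((totalPullback u v).map f)).trans ((pullback.lift_snd_assoc _ _ _ _).symm.trans
        ((congrArg (_ ≫ ·) (pullback.lift_snd _ _ _).symm).trans (Category.assoc _ _ _).symm))))))
    ((Category.comp_id _).trans (Category.id_comp _).symm)

/-- The comparison of `A ×_B (B ×_D C) ⟶ B ×_D C` with `A ×_D C ⟶ B ×_D C`. -/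
noncomputable def ofCospan {u : I ⥤ Arrow E} {v : J ⥤ Arrow E} (Λ : Lifting u A.RAlgForget)
    (M : Lifting A.LcoalgForget v) :
    cospan Λ M ⋙ A.frobeniusPullback ⟶ totalPullback u v where
  app x := ofIteratedPullback x.w (v.obj x.base).hom
  naturality _ y _ := Arrow.hom_ext _ _ (pullback.hom_ext (f := y.a) (g := (v.obj y.base).hom)
    ((Category.assoc _ _ _).trans ((congrArg (_ ≫ ·) (pullback.lift_fst _ _ _)).trans
      ((pullback.lift_fst _ _ _).trans ((pullback.lift_fst_assoc _ _ _ _).symm.trans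
        ((congrArg (_ ≫ ·) (pullback.lift_fst _ _ _).symm).trans (Category.assoc _ _ _).symm)))))
    ((Category.assoc _ _ _).trans ((congrArg (_ ≫ ·) (pullback.lift_snd _ _ _)).trans
      ((pullback.lift_snd_assoc _ _ _ _).trans ((Category.assoc _ _ _).trans
        ((congrArg (_ ≫ ·) (pullback.lift_snd _ _ _)).trans ((Category.assoc _ _ _).symm.trans
          ((pullback.lift_snd_assoc _ _ _ _).symm.trans ((congrArg (_ ≫ ·)
            (pullback.lift_snd _ _ _).symm).trans (Category.assoc _ _ _).symm)))))))))
    ((Category.comp_id _).trans (Category.id_comp _).symm)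

lemma toCospan_ofCospan {u : I ⥤ Arrow E} {v : J ⥤ Arrow E} (Λ : Lifting u A.RAlgForget)
    (M : Lifting A.LcoalgForget v) : toCospan Λ M ≫ ofCospan Λ M = 𝟙 _ :=
  NatTrans.ext (funext fun x => toIteratedPullback_ofIteratedPullback x.w (v.obj x.base).hom)

/-- The triangle in `E` given by a cospan of a coalgebra and an algebra. -/
def triangle (A : AWFS E) :
    StrictPullback (A.LcoalgForget ⋙ Arrow.rightFunc) (A.RalgForget ⋙ Arrow.rightFunc) ⥤
      Triangle A.LcoalgForget (A.RalgForget ⋙ Arrow.rightFunc) where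
  obj x := ⟨x.snd, x.fst, (A.LcoalgForget.obj x.fst).hom ≫ eqToHom x.w, eqToHom x.w, rfl⟩
  map f := ⟨f.snd, f.fst, f.w⟩

/-- The comparison of `A ×_D C ⟶ C` with `A ×_D C ⟶ B ×_D C` for an identification of `B`
with `D`. -/
noncomputable def toTriangle (A : AWFS E) :
    A.frobeniusPullback ⟶ A.triangle ⋙ totalPullback A.LcoalgForget A.RalgForget where
  app x := toPullbackIso (A.LcoalgForget.obj x.fst).hom (A.RalgForget.obj x.snd).hom (eqToIso x.w)
  naturality x y f := by
    let p (z : StrictPullback (A.LcoalgForget ⋙ Arrow.rightFunc)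
        (A.RalgForget ⋙ Arrow.rightFunc)) :=
      toPullbackIso (A.LcoalgForget.obj z.fst).hom (A.RalgForget.obj z.snd).hom (eqToIso z.w)
    have e : (A.frobeniusPullback.map f ≫ p y).right ≫
        pullback.snd (eqToHom y.w) (A.RalgForget.obj y.snd).hom =
      (p x ≫ (A.triangle ⋙ totalPullback A.LcoalgForget A.RalgForget).map f).right ≫
        pullback.snd (eqToHom y.w) (A.RalgForget.obj y.snd).hom :=
      (Category.assoc _ _ _).trans ((congrArg (_ ≫ ·) (pullback.lift_snd _ _ _)).trans
        ((Category.comp_id _).trans ((Category.id_comp _).symm.trans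
          ((pullback.lift_snd_assoc _ _ _ _).symm.trans ((congrArg (_ ≫ ·)
            (pullback.lift_snd _ _ _).symm).trans (Category.assoc _ _ _).symm)))))
    refine Arrow.hom_ext _ _ ((Category.comp_id _).trans (Category.id_comp _).symm)
      (pullback.hom_ext (f := eqToHom y.w) (g := (A.RalgForget.obj y.snd).hom) ?_ e)
    -- The first projection is determined by the second: `eqToHom y.w` is invertible, and after
    -- composing with it the pullback condition reduces the claim to `e`.
    refine (cancel_mono (eqToHom y.w)).1 ((Category.assoc _ _ _).trans ((congrArg (_ ≫ ·)
      pullback.condition).trans ((Category.assoc _ _ _).symm.trans ((congrArg (· ≫ _) e).trans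
        ((Category.assoc _ _ _).trans ((congrArg (_ ≫ ·) pullback.condition.symm).trans
          (Category.assoc _ _ _).symm))))))

/-- The comparison of `A ×_D C ⟶ B ×_D C` with `A ×_D C ⟶ C` for an identification of `B`
with `D`. -/
noncomputable def ofTriangle (A : AWFS E) :
    A.triangle ⋙ totalPullback A.LcoalgForget A.RalgForget ⟶ A.frobeniusPullback where
  app x := ofPullbackIso (A.LcoalgForget.obj x.fst).hom (A.RalgForget.obj x.snd).hom (eqToIso x.w)
  naturality _ _ _ := Arrow.hom_ext _ _
    ((Category.comp_id _).trans (Category.id_comp _).symm) (pullback.lift_snd _ _ _)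

lemma toTriangle_ofTriangle (A : AWFS E) : A.toTriangle ≫ A.ofTriangle = 𝟙 _ :=
  NatTrans.ext (funext fun _ => toPullbackIso_ofPullbackIso _ _ _)

/-- The functorial Frobenius condition gives fillers for pullbacks of the arrows `u i` along arrows
against which coalgebras lift. -/
lemma FunctorialFrobenius.lifting (h : A.FunctorialFrobenius) {u : I ⥤ Arrow E} {v : J ⥤ Arrow E}
    (Λ : Lifting u A.RAlgForget) (M : Lifting A.LcoalgForget v) :
    Nonempty (Lifting (totalPullback u v) A.RAlgForget) :=
  (functorialFrobenius_iff.1 h).map fun N =>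
    (N.precomp (cospan Λ M) (𝟭 _)).retractLeft (toCospan Λ M) (ofCospan Λ M)
      (toCospan_ofCospan Λ M)

/-- Algebras for the pointed endofunctor are retracts of algebras for the monad, in a way that is
compatible with pulling back along them. -/
def reindexFree (A : AWFS E) (u : I ⥤ Arrow E) :
    Triangle u (A.RalgForget ⋙ Arrow.rightFunc) ⥤ Triangle u (A.RAlgForget ⋙ Arrow.rightFunc) where
  obj x := ⟨A.freeAlg.obj x.base, x.i, x.a, x.b, x.w⟩
  map f := ⟨A.freeAlg.map f.base, f.i, f.w⟩
  map_id x := Triangle.Hom.ext (A.freeAlg.map_id x.base) rfl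
  map_comp f g := Triangle.Hom.ext (A.freeAlg.map_comp f.base g.base) rfl

/-- The inclusion of an algebra in a free algebra. -/
def toFreeTriangle (A : AWFS E) (u : I ⥤ Arrow E) :
    Triangle.prod u A.RalgForget ⟶ A.reindexFree u ⋙ Triangle.prod u A.RAlgForget where
  app x := ⟨A.toFreeAlg.app x.base, 𝟙 (u.obj x.i),
    (Category.id_comp _).trans (Category.comp_id _).symm⟩
  naturality _ _ f := Triangle.Hom.ext (A.toFreeAlg.naturality f.base)
    ((Category.comp_id _).trans (Category.id_comp _).symm)

/-- The retraction of a free algebra onto an algebra. -/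
def ofFreeTriangle (A : AWFS E) (u : I ⥤ Arrow E) :
    A.reindexFree u ⋙ Triangle.prod u A.RAlgForget ⟶ Triangle.prod u A.RalgForget where
  -- By the unit law the right side of an algebra structure is an identity, so the retraction is
  -- compatible with the map to the base.
  app x := ⟨A.ofFreeAlg.app x.base, 𝟙 (u.obj x.i), (Category.id_comp _).trans
    ((Category.comp_id _).symm.trans (congrArg (x.b ≫ ·)
      ((congrArg (fun z => Arrow.Hom.right z) x.base.property).symm.trans
        (Category.id_comp x.base.obj.str.right))))⟩
  naturality _ _ f := Triangle.Hom.ext (A.ofFreeAlg.naturality f.base)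
    ((Category.comp_id _).trans (Category.id_comp _).symm)

lemma toFreeTriangle_ofFreeTriangle (A : AWFS E) (u : I ⥤ Arrow E) :
    A.toFreeTriangle u ≫ A.ofFreeTriangle u = 𝟙 _ :=
  NatTrans.ext (funext fun x => Triangle.Hom.ext x.base.property (Category.id_comp _))

/-- Fillers for pullbacks along algebras for the monad give fillers for pullbacks along algebras
for the pointed endofunctor. -/
noncomputable def liftingOfFree {u : I ⥤ Arrow E} {r : Y ⥤ Arrow E}
    (Λ : Lifting (totalPullback u A.RAlgForget) r) : Lifting (totalPullback u A.RalgForget) r :=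
  let Q := pullbackQ ⋙ Triangle.arrow (𝟭 (Arrow E)) (𝟭 E)
  (Λ.precomp (A.reindexFree u) (𝟭 _)).retractLeft
    (Functor.whiskerRight (A.toFreeTriangle u) Q) (Functor.whiskerRight (A.ofFreeTriangle u) Q)
    ((Functor.whiskerRight_comp _ _ _).symm.trans ((congrArg (Functor.whiskerRight · Q)
      (A.toFreeTriangle_ofFreeTriangle u)).trans (Functor.whiskerRight_id' _)))

/-- Fillers for pullbacks of coalgebras along algebras give the functorial Frobenius condition. -/
lemma FunctorialFrobenius.of_lifting
    (Λ : Lifting (totalPullback A.LcoalgForget A.RAlgForget) A.RAlgForget) :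
    A.FunctorialFrobenius :=
  functorialFrobenius_iff.2 ⟨((liftingOfFree Λ).precomp A.triangle (𝟭 _)).retractLeft A.toTriangle
    A.ofTriangle A.toTriangle_ofTriangle⟩

end AWFS

end FrobeniusLifting

/-! ### Transfer along freeness, and the equivalence -/

lemma AWFS.IsAlgebraicallyFreeOn.exists_functor {E : Type u} [Category.{v} E] {I : Type u₁}
    [Category.{v₁} I] {u : I ⥤ Arrow E} {A : AWFS E} (hA : A.IsAlgebraicallyFreeOn u) :
    (∃ Φ : A.RAlg ⥤ RightMap u, Φ ⋙ RightMap.forget u = A.RAlgForget) ∧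
      ∃ Ψ : RightMap u ⥤ A.RAlg, Ψ ⋙ A.RAlgForget = RightMap.forget u := by
  obtain ⟨Φ, Ψ, -, h, hΦ⟩ := hA
  refine ⟨⟨Φ, hΦ⟩, Ψ, ?_⟩
  rw [← hΦ]
  exact congrArg (· ⋙ RightMap.forget u) h

lemma Lifting.nonempty_of_comp_right {E : Type u} [Category.{v} E] {X : Type u₁} [Category.{v₁} X]
    {Y : Type u₂} [Category.{v₂} Y] {Y' : Type u₃} [Category.{v₃} Y'] {G : X ⥤ Arrow E}
    {r : Y ⥤ Arrow E} {r' : Y' ⥤ Arrow E} (Λ : Lifting G r) (F : Y' ⥤ Y) (hF : F ⋙ r = r') :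
    Nonempty (Lifting G r') := by
  subst hF
  exact ⟨Λ.precomp (𝟭 _) F⟩

/-- Exchanges monad algebras and right `u`-maps in the family along which one pulls back; its
companion above does so in the family lifted against. -/
lemma Lifting.nonempty_totalPullback_of_comp {E : Type u} [Category.{v} E] [HasPullbacks E]
    {I : Type u₁} [Category.{v₁} I] {J : Type u₂} [Category.{v₂} J] {J' : Type u₃}
    [Category.{v₃} J'] {Y : Type u₄} [Category.{v₄} Y] {u : I ⥤ Arrow E} {v : J ⥤ Arrow E}
    {v' : J' ⥤ Arrow E} {r : Y ⥤ Arrow E} (Λ : Lifting (totalPullback u v) r) (F : J' ⥤ J)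
    (hF : F ⋙ v = v') : Nonempty (Lifting (totalPullback u v') r) := by
  subst hF
  exact ⟨Λ.precomp (Triangle.reindex u v F) (𝟭 _)⟩

end AlgFrobenius

theorem mainTheorem2 {E : Type u} [Category.{v} E] [HasPullbacks E] [HasPushforwards E]
    {I : Type u₁} [Category.{v₁} I] (u : I ⥤ Arrow E) (A : AWFS E)
    (hA : A.IsAlgebraicallyFreeOn u) :
    List.TFAE
      [A.FunctorialFrobenius,
       GeneralizedFrobenius u A.RAlgForget A.LcoalgForget,
       GeneralizedFrobenius u (RightMap.forget u) (LeftMap.forget (RightMap.forget u)),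
       PushforwardFrobenius u A.RAlgForget u,
       PushforwardFrobenius u (RightMap.forget u) u] := by
  obtain ⟨⟨Φ, hΦ⟩, Ψ, hΨ⟩ := hA.exists_functor
  -- Algebras are right `u`-maps through `Φ`, so the generators lift against algebras and hence
  -- carry coalgebra structures.
  obtain ⟨Λ⟩ := (RightMap.lifting u).nonempty_of_comp_right Φ hΦ
  have M : Lifting A.LcoalgForget A.RAlgForget := A.lifting.precomp (𝟭 _) A.algOfAlg
  tfae_have 1 → 2 := fun h => AWFS.generalizedFrobenius_iff.2 (h.lifting Λ M)
  tfae_have 2 → 4 := fun h =>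
    (AWFS.generalizedFrobenius_iff.1 h).elim fun N =>
      pushforwardFrobenius_iff.2 (N.nonempty_of_comp_right Ψ hΨ)
  tfae_have 3 ↔ 5 := generalizedFrobenius_leftMap_iff.trans pushforwardFrobenius_iff.symm
  tfae_have 4 → 5 := fun h => (pushforwardFrobenius_iff.1 h).elim fun N =>
    pushforwardFrobenius_iff.2 (N.nonempty_totalPullback_of_comp Ψ hΨ)
  tfae_have 5 → 1 := fun h => by
    obtain ⟨M'⟩ := M.nonempty_of_comp_right Ψ hΨ
    -- Through `M'` the generators are replaced by all coalgebras, at the level of pushforwards.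
    -- What remains is to replace right `u`-maps by algebras in both places, using `Φ`.
    obtain ⟨N⟩ := pushforwardFrobenius_iff.1 (h.of_lifting M')
    obtain ⟨N'⟩ := N.nonempty_totalPullback_of_comp Φ hΦ
    obtain ⟨N''⟩ := N'.nonempty_of_comp_right Φ hΦ
    exact .of_lifting N''
  tfae_finish
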